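/- A (finite, undirected) temporal graph $\mathcal{G}=(G,\lambda)$ consists of a finite simple undirected graph $G=(V,E)$, called the underlying graph, and a labeling $\lambda$ that assigns to every edge a nonempty finite set of natural numbers (time labels). It is happy if every edge has exactly one label and no two distinct edges with a common endpoint share a label. A temporal path from $u$ to $v$ is a path in $G$ from $u$ to $v$ with edges $e_1,\dots,e_k$ together with times $t_1\le\dots\le t_k$ such that $t_i\in\lambda(e_i)$ for all $i$. For $S\subseteq V$, $\mathcal{G}[S]$ denotes the temporal graph with underlying graph $G[S]$ whose edges keep their labels. The set $S$ is a closed temporally connected component (closed tcc) of $\mathcal{G}$ if for all $u,v\in S$ there is a temporal path from $u$ to $v$ in $\mathcal{G}[S]$; it is nontrivial if $|S|\ge 3$. **Corollary.** Let $\mathcal{G}$ be a happy undirected temporal graph whose underlying graph has girth at least $5$ (that is, contains no cycle of length $3$ or $4$; acyclic graphs have girth $\infty$). Then each nontrivial closed tcc of $\mathcal{G}$ has size at least $17$. -/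

import Mathlib

/-- An undirected temporal graph `(G, lam)` on the vertex set `V`: a simple graph `G` (the
underlying graph) in which every edge carries a nonempty finite set of natural numbers as time
labels. The labeling is extended to all unordered pairs by the empty set outside the edges. -/
structure TemporalGraph (V : Type*) where
  /-- the underlying graph -/
  graph : SimpleGraph V
  /-- the set of time labels of an edge -/
  labels : Sym2 V → Finset ℕ
  labels_nonempty_iff : ∀ e : Sym2 V, (labels e).Nonempty ↔ e ∈ graph.edgeSet

namespace TemporalGraph

variable {V : Type*}

/-- Simple: every edge has exactly one time label. -/
def IsSimple (T : TemporalGraph V) : Prop :=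
  ∀ e ∈ T.graph.edgeSet, (T.labels e).card = 1

/-- Proper: two distinct edges with a common endpoint never share a time label. -/
def IsProper (T : TemporalGraph V) : Prop :=
  ∀ e ∈ T.graph.edgeSet, ∀ f ∈ T.graph.edgeSet, e ≠ f → (∃ v, v ∈ e ∧ v ∈ f) →
    Disjoint (T.labels e) (T.labels f)

/-- Happy: simple and proper. -/
def IsHappy (T : TemporalGraph V) : Prop :=
  T.IsSimple ∧ T.IsProper

/-- There is a temporal path from `u` to `v`: a path in the underlying graph with edges
`e₁, …, eₖ`, together with a nondecreasing sequence of times `t₁, …, tₖ` such that `tᵢ` is a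
label of `eᵢ` for every `i`. -/
def HasTemporalPath (T : TemporalGraph V) (u v : V) : Prop :=
  ∃ (p : T.graph.Walk u v) (times : List ℕ), p.IsPath ∧ times.Pairwise (· ≤ ·) ∧
    List.Forall₂ (fun e t => t ∈ T.labels e) p.edges times

/-- Temporally connected: every ordered pair of vertices is joined by a temporal path. -/
def IsTemporallyConnected (T : TemporalGraph V) : Prop :=
  ∀ u v : V, T.HasTemporalPath u v

/-- The temporal subgraph induced by the vertex set `S`; edges inside `S` keep their labels. -/
def induce (T : TemporalGraph V) (S : Set V) : TemporalGraph S where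
  graph := T.graph.induce S
  labels e := T.labels (e.map Subtype.val)
  labels_nonempty_iff e := by
    rw [T.labels_nonempty_iff]
    induction e with
    | h x y => simp

/-- A closed temporally connected component (closed tcc): a vertex set inducing a temporally
connected subgraph, so that all the temporal paths remain inside the set. -/
def IsClosedTCC (T : TemporalGraph V) (S : Finset V) : Prop :=
  (T.induce (S : Set V)).IsTemporallyConnected

/-- A closed tcc of an undirected temporal graph is nontrivial if it has at least 3 vertices. -/
def IsNontrivialClosedTCC (T : TemporalGraph V) (S : Finset V) : Prop :=
  T.IsClosedTCC S ∧ 3 ≤ S.card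

end TemporalGraph

/-! Restrict to the component; let n be its order and m its number of edges. Read the edges in time
order as telephone calls: temporal connectivity says that everybody's information reaches everybody.
For girth at least 5 and n ≤ 16 this needs m ≥ 2n - 3 calls (`Scheme.card_add_card_le`, with all n
single persons both as senders and as receivers), whereas such a graph with 3 ≤ n ≤ 16 has m ≤ 2n -
4 (`degSum_add_six_lt`). Hence n ≥ 17.

Upper bound on m. Two vertices have at most one common neighbour, and none if they are adjacent.
Cauchy–Schwarz then settles n ≤ 13. For n = 14, 15, 16 one deletes vertices of small degree, counts
balls of radius two, and analyses the few degree distributions that remain.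

Lower bound on m. The statement is generalised to #P + #X ≤ |L| + 3, where senders P and receivers X
may also be edges whose ends pool their information, all of them different from each other and from
the calls in L. If somebody learns everything, the last call among such persons can be postponed to
the end and turned into a receiving pair: one call less, and at most one receiver less. Time
reversal gives the same for senders. When neither reduction applies, all senders and receivers are
genuine pairs.

Information stays inside a connected component of the call graph, so sender pairs and receiver
pairs, read as pairs of components, cross-intersect. If there were too few calls, at least four
components would occur. Either all pairs share a component, and then the other components force
cycles and hence calls; or there are exactly four components arranged in a square. In the latter
case the set A of persons involved spans at least 2|A| - 4 edges, against the extremal bound for |A|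
≤ 14. For |A| = 16, two of the components are single vertices of degree at most two, and deleting
them leaves too many edges on 14 vertices. -/

namespace SimpleGraph

open Finset

/-- No cycles of length three or four. -/
structure GirthGeFive {V : Type*} (G : SimpleGraph V) : Prop where
  triangle_free : ∀ ⦃a b c⦄, G.Adj a b → G.Adj b c → ¬ G.Adj a c
  common_unique : ∀ ⦃a c b d⦄, a ≠ c → G.Adj a b → G.Adj b c → G.Adj a d → G.Adj d c → b = d

/-! ### Degree counting at girth five, and extremal bounds for ten to twelve vertices -/

section DegIn

set_option linter.unusedSectionVars false

variable {V : Type*} [DecidableEq V] (G : SimpleGraph V) [DecidableRel G.Adj]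

/-- The number of neighbours of `v` in `W`. -/
def degIn (W : Finset V) (v : V) : ℕ := #(W.filter (G.Adj v))

/-- The degree sum of the subgraph induced by `W`, that is, twice its number of edges. -/
def degSum (W : Finset V) : ℕ := ∑ v ∈ W, G.degIn W v

/-- The vertices of `W` at distance at least three from `v` in the subgraph induced by `W`. -/
def farIn (W : Finset V) (v : V) : Finset V :=
  W.filter fun w => w ≠ v ∧ ¬ G.Adj v w ∧ ∀ u ∈ W, ¬ (G.Adj v u ∧ G.Adj u w)

variable {G}

theorem degIn_mono {S T : Finset V} (h : S ⊆ T) (v : V) : G.degIn S v ≤ G.degIn T v :=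
  card_le_card (filter_subset_filter _ h)

theorem degIn_erase {W : Finset V} {v : V} (hv : v ∈ W) (u : V) :
    G.degIn (W.erase v) u + (if G.Adj u v then 1 else 0) = G.degIn W u := by
  unfold degIn
  rw [filter_erase]
  split_ifs with h
  · exact card_erase_add_one (by simp [hv, h])
  · rw [erase_eq_of_notMem (by simp [h]), add_zero]

theorem degIn_erase_of_not_adj {W : Finset V} {v u : V} (h : ¬ G.Adj u v) :
    G.degIn (W.erase v) u = G.degIn W u := by
  unfold degIn
  rw [filter_erase, erase_eq_of_notMem (by simp [h])]

theorem degIn_union {S T : Finset V} (h : Disjoint S T) (v : V) :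
    G.degIn (S ∪ T) v = G.degIn S v + G.degIn T v := by
  unfold degIn
  rw [filter_union, card_union_of_disjoint (disjoint_filter_filter h)]

theorem degSum_erase {W : Finset V} {v : V} (hv : v ∈ W) :
    G.degSum (W.erase v) + 2 * G.degIn W v = G.degSum W := by
  have h1 : G.degSum W = G.degIn W v + ∑ u ∈ W.erase v, G.degIn W u :=
    (add_sum_erase W (G.degIn W) hv).symm
  have h2 : ∑ u ∈ W.erase v, G.degIn W u = G.degSum (W.erase v) + G.degIn W v := by
    have : G.degIn W v = ∑ u ∈ W.erase v, (if G.Adj u v then 1 else 0) := by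
      rw [sum_boole]
      unfold degIn
      simp only [Nat.cast_id]
      congr 1
      ext u
      simp only [mem_filter, mem_erase, G.adj_comm u v]
      constructor
      · rintro ⟨h, h'⟩
        exact ⟨⟨h'.ne', h⟩, h'⟩
      · rintro ⟨⟨-, h⟩, h'⟩
        exact ⟨h, h'⟩
    rw [this]
    unfold degSum
    rw [← sum_add_distrib]
    exact sum_congr rfl fun u _ => (degIn_erase hv u).symm
  omega

theorem even_degSum (W : Finset V) : Even (G.degSum W) := by
  induction W using Finset.strongInduction with
  | H W ih =>
    rcases W.eq_empty_or_nonempty with rfl | ⟨v, hv⟩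
    · simp [degSum]
    · rw [← degSum_erase hv]
      exact (ih _ (erase_ssubset hv)).add (even_two_mul _)

theorem sum_degIn_comm (S T : Finset V) :
    ∑ a ∈ S, G.degIn T a = ∑ b ∈ T, G.degIn S b := by
  have := sum_card_bipartiteAbove_eq_sum_card_bipartiteBelow (s := S) (t := T) G.Adj
  unfold degIn
  simp only [bipartiteAbove, bipartiteBelow] at this
  simpa only [G.adj_comm] using this

/-- Two distinct vertices have at most one common neighbour, and none if they are adjacent. -/
theorem sum_sq_degIn_le (hG : G.GirthGeFive) (S T : Finset V) :
    ∑ b ∈ T, G.degIn S b ^ 2 + G.degSum S + #S ≤ ∑ b ∈ T, G.degIn S b + #S ^ 2 := by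
  set Z : V → Finset (V × V) := fun b => (S.filter (G.Adj b)).offDiag with hZ
  set Q : Finset (V × V) := S.offDiag.filter fun x => G.Adj x.1 x.2 with hQ
  have hZc : ∀ b, #(Z b) + G.degIn S b = G.degIn S b ^ 2 := by
    intro b
    simp only [hZ, offDiag_card]
    change G.degIn S b * G.degIn S b - G.degIn S b + G.degIn S b = _
    rw [Nat.sub_add_cancel (Nat.le_mul_self _), sq]
  have hQc : #Q = G.degSum S := by
    have : Q = (S.sigma fun v => S.filter (G.Adj v)).map
        (Equiv.sigmaEquivProd V V).toEmbedding := by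
      ext ⟨a, b⟩
      simp only [hQ, mem_filter, mem_offDiag, mem_map, mem_sigma, Equiv.coe_toEmbedding,
        Equiv.sigmaEquivProd_apply, Sigma.exists, Prod.mk.injEq]
      constructor
      · rintro ⟨⟨h1, h2, -⟩, h⟩
        exact ⟨a, b, ⟨h1, h2, h⟩, rfl, rfl⟩
      · rintro ⟨a, b, ⟨h1, h2, h⟩, rfl, rfl⟩
        exact ⟨⟨h1, h2, h.ne⟩, h⟩
    rw [this, card_map, card_sigma]
    rfl
  have hdis : (T : Set V).PairwiseDisjoint Z := by
    intro b _ b' _ hbb'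
    rw [Function.onFun, Finset.disjoint_left]
    rintro ⟨x, y⟩ h1 h2
    refine hbb' ?_
    simp only [hZ, mem_offDiag, mem_filter] at h1 h2
    exact hG.common_unique h1.2.2 h1.1.2.symm h1.2.1.2 h2.1.2.symm h2.2.1.2
  have hQZ : Disjoint (T.biUnion Z) Q := by
    rw [Finset.disjoint_left]
    rintro ⟨x, y⟩ h1 h2
    simp only [hZ, hQ, mem_biUnion, mem_offDiag, mem_filter] at h1 h2
    obtain ⟨b, -, h1⟩ := h1
    exact hG.triangle_free h1.1.2.symm h1.2.1.2 h2.2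
  have hsub : T.biUnion Z ∪ Q ⊆ S.offDiag := by
    refine union_subset (biUnion_subset.2 fun b _ => offDiag_mono (filter_subset _ _))
      (filter_subset _ _)
  have hcard := card_le_card hsub
  rw [card_union_of_disjoint hQZ, card_biUnion hdis, hQc, offDiag_card] at hcard
  have h1 : ∑ b ∈ T, G.degIn S b ^ 2 = ∑ b ∈ T, #(Z b) + ∑ b ∈ T, G.degIn S b := by
    rw [← sum_add_distrib]
    exact sum_congr rfl fun b _ => (hZc b).symm
  have h2 : #S ≤ #S * #S := Nat.le_mul_self _
  rw [h1, sq]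
  omega

/-- Cauchy–Schwarz applied to the count of common neighbours with S = T = W; for n vertices the
degree sum is at most n√(n - 1). -/
theorem degSum_sq_le (hG : G.GirthGeFive) (W : Finset V) :
    G.degSum W ^ 2 + #W ^ 2 ≤ #W ^ 3 := by
  have h1 := sum_sq_degIn_le hG W W
  have h2 := sq_sum_le_card_mul_sum_sq (s := W) (f := G.degIn W)
  have h3 : ∑ v ∈ W, G.degIn W v ^ 2 + #W ≤ #W ^ 2 := by
    unfold degSum at h1
    omega
  calc G.degSum W ^ 2 + #W ^ 2 ≤ #W * ∑ v ∈ W, G.degIn W v ^ 2 + #W * #W := by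
        rw [sq #W]
        exact Nat.add_le_add_right h2 _
    _ = #W * (∑ v ∈ W, G.degIn W v ^ 2 + #W) := by ring
    _ ≤ #W * #W ^ 2 := Nat.mul_le_mul_left _ h3
    _ = #W ^ 3 := by ring

/-- The vertices within distance two of `v` are counted by the degrees of the neighbours. -/
theorem sum_degIn_neighbors_add_card_farIn_le (hG : G.GirthGeFive) {W : Finset V} {v : V}
    (hv : v ∈ W) :
    ∑ u ∈ W.filter (G.Adj v), G.degIn W u + #(G.farIn W v) + 1 ≤ #W := by
  set N := W.filter (G.Adj v) with hN
  set Z : V → Finset V := fun u => (W.filter (G.Adj u)).erase v with hZ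
  have hZc : ∀ u ∈ N, #(Z u) + 1 = G.degIn W u := by
    intro u hu
    simp only [hN, mem_filter] at hu
    exact card_erase_add_one (by simp [hv, hu.2.symm])
  have hdis : (N : Set V).PairwiseDisjoint Z := by
    intro u hu u' hu' h
    simp only [hN, coe_filter, Set.mem_ofPred_eq] at hu hu'
    rw [Function.onFun, Finset.disjoint_left]
    intro x h1 h2
    refine h ?_
    simp only [hZ, mem_erase, mem_filter] at h1 h2
    exact hG.common_unique h1.1.symm hu.2 h1.2.2 hu'.2 h2.2.2
  have h1 : Disjoint (N.biUnion Z) N := by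
    rw [Finset.disjoint_left]
    intro x h1 h2
    simp only [hZ, hN, mem_biUnion, mem_erase, mem_filter] at h1 h2
    obtain ⟨u, hu, h1⟩ := h1
    exact hG.triangle_free hu.2 h1.2.2 h2.2
  have h2 : Disjoint (N.biUnion Z ∪ N) (G.farIn W v) := by
    rw [Finset.disjoint_left]
    intro x h1 h2
    simp only [farIn, hZ, hN, mem_union, mem_biUnion, mem_erase, mem_filter] at h1 h2
    rcases h1 with ⟨u, hu, h1⟩ | h1
    · exact h2.2.2.2 u hu.1 ⟨hu.2, h1.2.2⟩
    · exact h2.2.2.1 h1.2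
  have h3 : Disjoint (N.biUnion Z ∪ N ∪ G.farIn W v) {v} := by
    rw [disjoint_singleton_right]
    simp [farIn, hZ, hN]
  have hsub : N.biUnion Z ∪ N ∪ G.farIn W v ∪ {v} ⊆ W := by
    intro x hx
    simp only [farIn, hZ, hN, mem_union, mem_biUnion, mem_erase, mem_filter, mem_singleton] at hx
    rcases hx with ((⟨u, hu, h1⟩ | h1) | h1) | rfl
    · exact h1.2.1
    · exact h1.1
    · exact h1.1
    · exact hv
  have hcard := card_le_card hsub
  rw [card_union_of_disjoint h3, card_union_of_disjoint h2, card_union_of_disjoint h1,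
    card_biUnion hdis, card_singleton] at hcard
  have h4 : ∑ u ∈ N, G.degIn W u = ∑ u ∈ N, #(Z u) + #N := by
    rw [card_eq_sum_ones, ← sum_add_distrib]
    exact sum_congr rfl fun u hu => (hZc u hu).symm
  omega

/-- Moore bound: the neighbours of v have disjoint sets of further neighbours, each of size at least
k - 1. -/
theorem degIn_mul_add_one_le (hG : G.GirthGeFive) {W : Finset V} {k : ℕ}
    (hk : ∀ v ∈ W, k ≤ G.degIn W v) {v : V} (hv : v ∈ W) : G.degIn W v * k + 1 ≤ #W := by
  have h1 := sum_degIn_neighbors_add_card_farIn_le hG hv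
  have h2 : G.degIn W v * k ≤ ∑ u ∈ W.filter (G.Adj v), G.degIn W u :=
    card_nsmul_le_sum _ _ _ fun u hu => hk u (mem_filter.1 hu).1
  omega

theorem sum_eq_of_two_values {W : Finset V} {f : V → ℕ} {k : ℕ}
    (h : ∀ v ∈ W, f v = k ∨ f v = k + 1) :
    ∑ v ∈ W, f v = k * #W + #(W.filter fun v => f v = k + 1) := by
  rw [card_filter, mul_comm, ← smul_eq_mul, ← sum_const, ← sum_add_distrib]
  refine sum_congr rfl fun v hv => ?_
  rcases h v hv with h | h <;> simp [h]

theorem degSum_le_of_card_eq_ten (hG : G.GirthGeFive) {W : Finset V} (hW : #W = 10) :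
    G.degSum W ≤ 30 := by
  have := degSum_sq_le hG W
  rw [hW] at this
  nlinarith

/-- Otherwise some vertex has degree at most 2, and deleting it leaves equality for ten vertices: a
3-regular graph of diameter two (the Petersen graph). A new vertex with two neighbours there closes
a triangle or a four-cycle. -/
theorem degSum_le_of_card_eq_eleven (hG : G.GirthGeFive) {W : Finset V} (hW : #W = 11) :
    G.degSum W ≤ 33 := by
  by_contra! hlt
  obtain ⟨v, hv, hd⟩ : ∃ v ∈ W, G.degIn W v ≤ 2 := by
    by_contra! h
    have h3 : ∀ v ∈ W, G.degIn W v ≤ 3 := fun v hv => by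
      have := degIn_mul_add_one_le hG h hv
      omega
    have := sum_le_card_nsmul _ _ _ h3
    change G.degSum W ≤ _ at this
    simp only [hW, smul_eq_mul] at this
    omega
  set U := W.erase v
  have hU : #U = 10 := by rw [card_erase_of_mem hv, hW]
  have h1 := degSum_erase (G := G) hv
  have h2 := degSum_le_of_card_eq_ten hG hU
  have h3 : G.degSum U = 30 := by change G.degSum U + _ = _ at h1; omega
  have hsq := sum_sq_degIn_le hG U U
  have hreg : ∀ u ∈ U, G.degIn U u = 3 := by
    -- The ten degrees sum to 30 and their squares to at most 90, so their variance vanishes.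
    have h0 : ∑ u ∈ U, ((G.degIn U u : ℤ) - 3) ^ 2 ≤ 0 := by
      have e : ∑ u ∈ U, ((G.degIn U u : ℤ) - 3) ^ 2
          = ∑ u ∈ U, (G.degIn U u : ℤ) ^ 2 - 6 * ∑ u ∈ U, (G.degIn U u : ℤ) + 9 * (#U : ℤ) := by
        rw [mul_sum, ← sum_sub_distrib, card_eq_sum_ones, Nat.cast_sum, mul_sum,
          ← sum_add_distrib]
        exact sum_congr rfl fun u _ => by push_cast; ring
      have h3' : ∑ u ∈ U, G.degIn U u = 30 := h3
      rw [h3, h3', hU] at hsq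
      rw [e, hU]
      have : ∑ u ∈ U, (G.degIn U u : ℤ) = 30 := by exact_mod_cast h3'
      have : ∑ u ∈ U, (G.degIn U u : ℤ) ^ 2 ≤ 90 := by
        have : ∑ u ∈ U, G.degIn U u ^ 2 ≤ 90 := by omega
        exact_mod_cast this
      push_cast
      linarith
    intro u hu
    have h4 := single_le_sum (f := fun u => ((G.degIn U u : ℤ) - 3) ^ 2)
      (fun i _ => sq_nonneg _) hu
    have h5 : ((G.degIn U u : ℤ) - 3) ^ 2 = 0 := le_antisymm (h4.trans h0) (sq_nonneg _)
    have h6 := pow_eq_zero_iff (two_ne_zero) |>.1 h5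
    omega
  have hfar : ∀ u ∈ U, G.farIn U u = ∅ := by
    intro u hu
    have h4 := sum_degIn_neighbors_add_card_farIn_le hG hu
    have h5 : ∑ x ∈ U.filter (G.Adj u), G.degIn U x = 9 := by
      rw [sum_congr rfl fun x hx => hreg x (mem_filter.1 hx).1, sum_const]
      change G.degIn U u • 3 = 9
      rw [hreg u hu]
      rfl
    exact card_eq_zero.1 (by omega)
  have h5 : 1 < #(W.filter (G.Adj v)) := by change 1 < G.degIn W v; change G.degSum U + _ = _ at h1; omega
  obtain ⟨x, hx, y, hy, hxy⟩ := one_lt_card.1 h5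
  rw [mem_filter] at hx hy
  have hxU : x ∈ U := mem_erase.2 ⟨hx.2.ne', hx.1⟩
  have hyU : y ∈ U := mem_erase.2 ⟨hy.2.ne', hy.1⟩
  have hy' : y ∉ G.farIn U x := by rw [hfar x hxU]; exact notMem_empty _
  simp only [farIn, mem_filter, not_and, not_forall, not_not] at hy'
  obtain ⟨u, hu, hxu, huy⟩ := hy' hyU hxy.symm (hG.triangle_free hx.2.symm hy.2)
  exact (mem_erase.1 hu).1 (hG.common_unique hxy hx.2.symm hy.2 hxu huy).symm

theorem degSum_le_of_card_eq_twelve (hG : G.GirthGeFive) {W : Finset V} (hW : #W = 12) :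
    G.degSum W ≤ 37 := by
  by_contra! hlt
  obtain ⟨v, hv, hd⟩ : ∃ v ∈ W, G.degIn W v ≤ 2 := by
    by_contra! h
    have h3 : ∀ v ∈ W, G.degIn W v ≤ 3 := fun v hv => by
      have := degIn_mul_add_one_le hG h hv
      omega
    have := sum_le_card_nsmul _ _ _ h3
    change G.degSum W ≤ _ at this
    simp only [hW, smul_eq_mul] at this
    omega
  have h1 := degSum_erase (G := G) hv
  have h2 := degSum_le_of_card_eq_eleven hG (W := W.erase v) (by rw [card_erase_of_mem hv, hW])
  omega

end DegIn

end SimpleGraph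

/-! ### Extremal bounds for thirteen to fifteen vertices -/

namespace SimpleGraph

open Finset

section Extremal

set_option linter.unusedSectionVars false

variable {V : Type*} [DecidableEq V] {G : SimpleGraph V} [DecidableRel G.Adj]

/-- For values among consecutive integers, a bound on the square sum. -/
theorem five_mul_sum_le (T : Finset V) (f : V → ℕ) :
    5 * ∑ b ∈ T, f b ≤ ∑ b ∈ T, f b ^ 2 + 6 * #T := by
  rw [mul_sum, mul_comm 6, ← smul_eq_mul, ← sum_const, ← sum_add_distrib]
  -- Termwise this is (x - 2)(x - 3) ≥ 0, true for integers.
  refine sum_le_sum fun b _ => ?_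
  rcases le_or_gt (f b) 2 with h | h
  · interval_cases f b <;> norm_num
  · obtain ⟨k, hk⟩ := Nat.exists_eq_add_of_lt h
    rw [hk]
    nlinarith

/-- Equality case of the previous bound: every term (x - 2)(x - 3) has to vanish. -/
theorem eq_two_or_three_of_five_mul_sum_ge (T : Finset V) (f : V → ℕ)
    (h : ∑ b ∈ T, f b ^ 2 + 6 * #T ≤ 5 * ∑ b ∈ T, f b) : ∀ b ∈ T, f b = 2 ∨ f b = 3 := by
  intro b hb
  have h1 := five_mul_sum_le (T.erase b) f
  rw [← add_sum_erase T _ hb, ← add_sum_erase T _ hb, ← card_erase_add_one hb] at h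
  have h2 : f b ^ 2 + 6 ≤ 5 * f b := by omega
  have h3 : f b < 5 := by nlinarith
  interval_cases hf : f b <;> simp_all

theorem sum_degIn_eq_mul {W : Finset V} {k : ℕ} {A : Finset V}
    (h : ∀ v ∈ A, G.degIn W v = k) : ∑ v ∈ A, G.degIn W v = k * #A := by
  rw [sum_congr rfl h, sum_const, smul_eq_mul, mul_comm]

/-- If all degrees are three or four, the two degree classes. -/
theorem card_filter_degIn {W : Finset V} (h : ∀ v ∈ W, G.degIn W v = 3 ∨ G.degIn W v = 4) :
    G.degSum W = 3 * #W + #(W.filter fun v => G.degIn W v = 4) ∧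
    #(W.filter fun v => G.degIn W v = 4) + #(W.filter fun v => G.degIn W v = 3) = #W := by
  refine ⟨sum_eq_of_two_values h, ?_⟩
  rw [← card_filter_add_card_filter_not (s := W) (fun v => G.degIn W v = 4)]
  congr 2
  refine filter_congr fun v hv => ?_
  have := h v hv
  omega

theorem degIn_eq_add_of_three_or_four {W : Finset V}
    (h : ∀ v ∈ W, G.degIn W v = 3 ∨ G.degIn W v = 4) (v : V) :
    G.degIn W v = G.degIn (W.filter fun v => G.degIn W v = 4) v +
      G.degIn (W.filter fun v => G.degIn W v = 3) v := by
  rw [← degIn_union]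
  · congr 1
    ext v
    simp only [mem_union, mem_filter]
    have := h v
    tauto
  · rw [Finset.disjoint_left]
    intro v h1 h2
    simp only [mem_filter] at h1 h2
    omega

/-- The degree sum over the neighbourhood when all degrees are three or four. -/
theorem sum_degIn_neighbors_of_three_or_four {W : Finset V}
    (h : ∀ v ∈ W, G.degIn W v = 3 ∨ G.degIn W v = 4) (v : V) :
    ∑ u ∈ W.filter (G.Adj v), G.degIn W u =
      3 * G.degIn W v + G.degIn (W.filter fun v => G.degIn W v = 4) v := by
  have h1 : G.degIn (W.filter fun v => G.degIn W v = 4) v =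
      ∑ u ∈ W.filter (G.Adj v), if G.degIn W u = 4 then 1 else 0 := by
    rw [← card_filter]
    unfold degIn
    rw [filter_filter, filter_filter]
    congr 1
    exact filter_congr fun u _ => and_comm
  have h2 : 3 * G.degIn W v = ∑ u ∈ W.filter (G.Adj v), 3 := by
    rw [sum_const, smul_eq_mul, mul_comm]
    rfl
  rw [h1, h2, ← sum_add_distrib]
  refine sum_congr rfl fun u hu => ?_
  rcases h u (mem_filter.1 hu).1 with h | h <;> simp [h]

/-- In a counterexample all degrees are 3 or 4. The ball around a vertex of degree 4 already fills
W, so the set A of these vertices is independent. Counting common neighbours of A inside B then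
gives a² - 23a + 78 ≥ 0 for a = #A, which fails for 5 ≤ a ≤ 13. -/
theorem degSum_le_of_card_eq_thirteen (hG : G.GirthGeFive) {W : Finset V} (hW : #W = 13) :
    G.degSum W ≤ 43 := by
  by_contra! hlt
  have hge : ∀ v ∈ W, 3 ≤ G.degIn W v := fun v hv => by
    have h1 := degSum_erase (G := G) hv
    have h2 := degSum_le_of_card_eq_twelve hG (W := W.erase v) (by rw [card_erase_of_mem hv, hW])
    omega
  have h34 : ∀ v ∈ W, G.degIn W v = 3 ∨ G.degIn W v = 4 := fun v hv => by
    have h1 := degIn_mul_add_one_le hG hge hv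
    have := hge v hv
    omega
  obtain ⟨hsum, hcard⟩ := card_filter_degIn h34
  set A := W.filter fun v => G.degIn W v = 4 with hA
  set B := W.filter fun v => G.degIn W v = 3 with hB
  have hAA : ∀ a ∈ A, G.degIn A a = 0 := fun a ha => by
    rw [hA, mem_filter] at ha
    have h1 := sum_degIn_neighbors_add_card_farIn_le hG ha.1
    rw [sum_degIn_neighbors_of_three_or_four h34, ← hA] at h1
    omega
  have hAB : ∀ a ∈ A, G.degIn B a = 4 := fun a ha => by
    have h1 := degIn_eq_add_of_three_or_four h34 a
    rw [← hA, ← hB, hAA a ha] at h1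
    rw [hA, mem_filter] at ha
    omega
  have h1 := sum_sq_degIn_le hG A B
  rw [← sum_degIn_comm A B, sum_degIn_eq_mul hAB] at h1
  have h2 := five_mul_sum_le B (G.degIn A)
  rw [← sum_degIn_comm A B, sum_degIn_eq_mul hAB] at h2
  have h3 : #A ≤ 13 := by omega
  have h4 : 5 ≤ #A := by omega
  have h5 : #B = 13 - #A := by omega
  rw [h5] at h2
  have h6 : G.degSum A = 0 := sum_eq_zero hAA
  rw [h6] at h1
  have h7 := degSum_sq_le hG W
  rw [hsum, hW] at h7
  interval_cases #A <;> omega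

/-- The counting used for thirteen vertices leaves one case: six vertices of degree 4 inducing a
perfect matching, each within distance two of everything. A vertex of degree 3 that misses both ends
of a matching edge then has too many neighbours. -/
theorem degSum_le_of_card_eq_fourteen (hG : G.GirthGeFive) {W : Finset V} (hW : #W = 14) :
    G.degSum W ≤ 47 := by
  by_contra! hlt
  have hge : ∀ v ∈ W, 3 ≤ G.degIn W v := fun v hv => by
    have h1 := degSum_erase (G := G) hv
    have h2 := degSum_le_of_card_eq_thirteen hG (W := W.erase v)
      (by rw [card_erase_of_mem hv, hW])
    omega
  have h34 : ∀ v ∈ W, G.degIn W v = 3 ∨ G.degIn W v = 4 := fun v hv => by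
    have h1 := degIn_mul_add_one_le hG hge hv
    have := hge v hv
    omega
  obtain ⟨hsum, hcard⟩ := card_filter_degIn h34
  have hdeg := degIn_eq_add_of_three_or_four (G := G) h34
  have hnb := sum_degIn_neighbors_of_three_or_four (G := G) h34
  set A := W.filter fun v => G.degIn W v = 4 with hA
  set B := W.filter fun v => G.degIn W v = 3 with hB
  have hAA : ∀ a ∈ A, G.degIn A a ≤ 1 := fun a ha => by
    rw [hA, mem_filter] at ha
    have h1 := sum_degIn_neighbors_add_card_farIn_le hG ha.1
    rw [hnb] at h1
    omega
  have hεA : G.degSum A ≤ #A := by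
    have := sum_le_card_nsmul _ _ _ hAA
    simpa [degSum] using this
  have hAB : ∑ a ∈ A, G.degIn B a + G.degSum A = 4 * #A := by
    unfold degSum
    rw [← sum_degIn_eq_mul (W := W) (k := 4) (A := A) fun v hv => (mem_filter.1 hv).2,
      ← sum_add_distrib]
    refine sum_congr rfl fun a _ => ?_
    rw [hdeg a, add_comm]
  have hB6 : ∀ b ∈ A, G.degIn A b ^ 2 = G.degIn A b := fun b hb => by
    have := hAA b hb
    interval_cases G.degIn A b <;> rfl
  have h1 := sum_sq_degIn_le hG A B
  rw [← sum_degIn_comm A B] at h1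
  have h2 := five_mul_sum_le B (G.degIn A)
  rw [← sum_degIn_comm A B] at h2
  have h7 := degSum_sq_le hG W
  rw [hsum, hW] at h7
  have h3 : #A ≤ 8 := by nlinarith
  have h4 : 6 ≤ #A := by omega
  have h5 : #B = 14 - #A := by omega
  -- With a = #A and ε the degree sum of A, the estimates combine to a² - 23a + 84 + 3ε ≥ 0, while ε
  -- ≤ a and 6 ≤ a ≤ 8.
  have h8 : #A = 6 ∧ G.degSum A = 6 := by
    obtain ⟨k, hk⟩ : ∃ k, k = #A := ⟨_, rfl⟩
    rw [← hk] at h1 h3 h4 h5 hAB hεA ⊢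
    rw [h5] at h2
    interval_cases k <;> omega
  obtain ⟨hA6, hε⟩ := h8
  have hA1 : ∀ a ∈ A, G.degIn A a = 1 := by
    have : ∑ a ∈ A, G.degIn A a = ∑ a ∈ A, 1 := by
      rw [← card_eq_sum_ones, hA6]
      exact hε
    exact (sum_eq_sum_iff_of_le hAA).1 this
  have hβ := eq_two_or_three_of_five_mul_sum_ge B (G.degIn A) (by
    rw [← sum_degIn_comm A B]
    rw [hA6] at h1
    omega)
  have hfar : ∀ a ∈ A, G.farIn W a = ∅ := fun a ha => by
    have h9 := hA1 a ha
    rw [hA, mem_filter] at ha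
    have h1 := sum_degIn_neighbors_add_card_farIn_le hG ha.1
    rw [hnb] at h1
    exact card_eq_zero.1 (by omega)
  obtain ⟨a, ha⟩ : A.Nonempty := card_pos.1 (by omega)
  obtain ⟨a', ha'⟩ : (A.filter (G.Adj a)).Nonempty := card_pos.1 (by
    have := hA1 a ha
    change 0 < G.degIn A a
    omega)
  rw [mem_filter] at ha'
  have huniq : ∀ x ∈ A, ∀ y ∈ A, G.Adj x y → ∀ z ∈ A, G.Adj x z → z = y := by
    intro x hx y hy hxy z hz hxz
    exact card_le_one.1 (hAA x hx) z (mem_filter.2 ⟨hz, hxz⟩) y (mem_filter.2 ⟨hy, hxy⟩)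
  -- B has eight elements, and a and a' have only three neighbours each in it.
  obtain ⟨o, hoB, hoa, hoa'⟩ : ∃ o ∈ B, ¬ G.Adj a o ∧ ¬ G.Adj a' o := by
    by_contra! h
    have hsub : B ⊆ B.filter (G.Adj a) ∪ B.filter (G.Adj a') := fun o ho => by
      simp only [mem_union, mem_filter, ho, true_and]
      exact or_iff_not_imp_left.2 (h o ho)
    have h9 := (card_le_card hsub).trans (card_union_le _ _)
    change #B ≤ G.degIn B a + G.degIn B a' at h9
    have h10 := hdeg a
    have h11 := hdeg a'
    rw [hA1 a ha, (mem_filter.1 ha).2] at h10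
    rw [hA1 a' ha'.1, (mem_filter.1 ha'.1).2] at h11
    omega
  -- The common neighbour of x and o cannot lie in A, because y is the only neighbour of x there.
  -- Applied to both ends of the matching edge, this gives o two neighbours in B besides at least
  -- two in A, although its degree is 3.
  have key : ∀ x ∈ A, ∀ y ∈ A, G.Adj x y → ¬ G.Adj x o → ¬ G.Adj y o →
      ∃ b ∈ B, G.Adj x b ∧ G.Adj o b := by
    intro x hx y hy hxy hxo hyo
    have h9 : o ∉ G.farIn W x := by rw [hfar x hx]; exact notMem_empty _
    simp only [farIn, mem_filter, not_and, not_forall, not_not] at h9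
    obtain ⟨u, hu, hxu, huo⟩ := h9 (mem_filter.1 hoB).1 (by
      rintro rfl
      have := (mem_filter.1 hx).2
      have := (mem_filter.1 hoB).2
      omega) hxo
    refine ⟨u, ?_, hxu, huo.symm⟩
    rcases h34 u hu with h | h
    · exact mem_filter.2 ⟨hu, h⟩
    · rw [huniq x hx y hy hxy u (mem_filter.2 ⟨hu, h⟩) hxu] at huo
      exact absurd huo hyo
  obtain ⟨b, hb, hab, hob⟩ := key a ha a' ha'.1 ha'.2 hoa hoa'
  obtain ⟨b', hb', hab', hob'⟩ := key a' ha'.1 a ha ha'.2.symm hoa' hoa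
  have hbb' : b ≠ b' := by
    rintro rfl
    exact hG.triangle_free hab hab'.symm ha'.2
  have h9 : 1 < G.degIn B o := one_lt_card.2 ⟨b, mem_filter.2 ⟨hb, hob⟩, b',
    mem_filter.2 ⟨hb', hob'⟩, hbb'⟩
  have h10 := hdeg o
  rw [(mem_filter.1 hoB).2] at h10
  have := hβ o hoB
  omega

/-- By the bound for fourteen vertices a counterexample has minimum degree 4, hence at least 4·4 + 1
= 17 vertices. -/
theorem degSum_le_of_card_eq_fifteen (hG : G.GirthGeFive) {W : Finset V} (hW : #W = 15) :
    G.degSum W ≤ 53 := by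
  by_contra! hlt
  have hge : ∀ v ∈ W, 4 ≤ G.degIn W v := fun v hv => by
    have h1 := degSum_erase (G := G) hv
    have h2 := degSum_le_of_card_eq_fourteen hG (W := W.erase v)
      (by rw [card_erase_of_mem hv, hW])
    omega
  obtain ⟨v, hv⟩ : W.Nonempty := card_pos.1 (by omega)
  have := degIn_mul_add_one_le hG hge hv
  have := hge v hv
  omega

end Extremal

end SimpleGraph

/-! ### The extremal bound for sixteen vertices -/

namespace SimpleGraph

open Finset

section Sixteen

set_option linter.unusedSectionVars false

variable {V : Type*} [DecidableEq V] {G : SimpleGraph V} [DecidableRel G.Adj]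

theorem disjoint_filter_adj_of_adj (hG : G.GirthGeFive) (B : Finset V) {x y : V}
    (h : G.Adj x y) : Disjoint (B.filter (G.Adj x)) (B.filter (G.Adj y)) := by
  rw [Finset.disjoint_left]
  intro z h1 h2
  rw [mem_filter] at h1 h2
  exact hG.triangle_free h1.2 h2.2.symm h

theorem disjoint_filter_adj_of_common (hG : G.GirthGeFive) {B : Finset V} {x y u : V}
    (hxy : x ≠ y) (h1 : G.Adj x u) (h2 : G.Adj u y) (hu : u ∉ B) :
    Disjoint (B.filter (G.Adj x)) (B.filter (G.Adj y)) := by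
  rw [Finset.disjoint_left]
  intro z h3 h4
  rw [mem_filter] at h3 h4
  exact hu (hG.common_unique hxy h1 h2 h3.2 h4.2.symm ▸ h3.1)

/-- A path on four vertices, each with two neighbours in a six-element set, is impossible. -/
theorem false_of_path_of_two_neighbors (hG : G.GirthGeFive) {B : Finset V} (hB : #B = 6)
    {p q r s : V} (hp : G.degIn B p = 2) (hq : G.degIn B q = 2) (hr : G.degIn B r = 2)
    (hs : G.degIn B s = 2) (hqB : q ∉ B) (hrB : r ∉ B) (hpr : p ≠ r) (hqs : q ≠ s)
    (h1 : G.Adj p q) (h2 : G.Adj q r) (h3 : G.Adj r s) : False := by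
  have hps : p ≠ s := by
    rintro rfl
    exact hG.triangle_free h1 h2 h3.symm
  set S := B \ (B.filter (G.Adj q) ∪ B.filter (G.Adj r)) with hS
  have hSc : #S = 2 := by
    rw [hS, card_sdiff_of_subset (union_subset (filter_subset _ _) (filter_subset _ _)),
      card_union_of_disjoint (disjoint_filter_adj_of_adj hG B h2)]
    change #B - (G.degIn B q + G.degIn B r) = 2
    omega
  have key : ∀ x, G.degIn B x = 2 → Disjoint (B.filter (G.Adj x)) (B.filter (G.Adj q)) →
      Disjoint (B.filter (G.Adj x)) (B.filter (G.Adj r)) → B.filter (G.Adj x) = S := by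
    -- The neighbourhoods of q and r use up four elements of B, so both p and s are adjacent to the
    -- same remaining two: a four-cycle.
    intro x hx hxq hxr
    refine eq_of_subset_of_card_le (subset_sdiff.2 ⟨filter_subset _ _,
      disjoint_union_right.2 ⟨hxq, hxr⟩⟩) ?_
    rw [hSc]
    exact hx.ge
  have e1 := key p hp (disjoint_filter_adj_of_adj hG B h1)
    (disjoint_filter_adj_of_common hG hpr h1 h2 hqB)
  have e2 := key s hs (disjoint_filter_adj_of_common hG hqs.symm h3.symm h2.symm hrB)
    (disjoint_filter_adj_of_adj hG B h3.symm)
  obtain ⟨x, hx, y, hy, hxy⟩ := one_lt_card.1 (show 1 < #S by omega)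
  have hxs := hx
  have hys := hy
  rw [← e1, mem_filter] at hx hy
  rw [← e2, mem_filter] at hxs hys
  exact hxy (hG.common_unique hps hx.2 hxs.2.symm hy.2 hys.2.symm)

/-- The structure of a hypothetical graph of girth at least five with sixteen vertices and
twenty-nine edges: six independent vertices of degree three, ten vertices of degree four. -/
theorem three_or_four_of_card_eq_sixteen (hG : G.GirthGeFive) {W : Finset V} (hW : #W = 16)
    (hlt : 58 ≤ G.degSum W) :
    G.degSum W = 58 ∧ (∀ v ∈ W, G.degIn W v = 3 ∨ G.degIn W v = 4) ∧
      ∀ v ∈ W, G.degIn W v = 3 → ∀ u ∈ W, G.Adj v u → 4 ≤ G.degIn W u := by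
  have hge : ∀ v ∈ W, 3 ≤ G.degIn W v := fun v hv => by
    have h1 := degSum_erase (G := G) hv
    have h2 := degSum_le_of_card_eq_fifteen hG (W := W.erase v)
      (by rw [card_erase_of_mem hv, hW])
    omega
  have hadj : ∀ v ∈ W, G.degIn W v = 3 → ∀ u ∈ W, G.Adj v u → 4 ≤ G.degIn W u := by
    intro v hv hd u hu huv
    have h1 := degSum_erase (G := G) hv
    have hu' : u ∈ W.erase v := mem_erase.2 ⟨huv.ne', hu⟩
    have h2 := degSum_erase (G := G) hu'
    have h3 := degSum_le_of_card_eq_fourteen hG (W := (W.erase v).erase u)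
      (by rw [card_erase_of_mem hu', card_erase_of_mem hv, hW])
    have h4 := degIn_erase (G := G) hv u
    rw [if_pos huv.symm] at h4
    omega
  have h58 : G.degSum W = 58 := by
    obtain ⟨v, hv, hd⟩ : ∃ v ∈ W, G.degIn W v ≤ 3 := by
      by_contra! h
      obtain ⟨v, hv⟩ : W.Nonempty := card_pos.1 (by omega)
      have := degIn_mul_add_one_le hG h hv
      have := h v hv
      omega
    have h1 := degSum_erase (G := G) hv
    have h2 := degSum_le_of_card_eq_fifteen hG (W := W.erase v)
      (by rw [card_erase_of_mem hv, hW])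
    obtain ⟨k, hk⟩ := even_degSum (G := G) W
    omega
  refine ⟨h58, fun v hv => ?_, hadj⟩
  by_contra! hne
  have hd : G.degIn W v = 5 := by
    have h1 := degIn_mul_add_one_le hG hge hv
    have := hge v hv
    omega
  have hq := sum_degIn_neighbors_add_card_farIn_le hG hv
  have h3 : ∑ u ∈ W.filter (G.Adj v), 3 = 15 := by
    rw [sum_const]
    change G.degIn W v • 3 = 15
    rw [hd]
    rfl
  have h4 : ∑ u ∈ W.filter (G.Adj v), 3 ≤ ∑ u ∈ W.filter (G.Adj v), G.degIn W u :=
    sum_le_sum fun u hu => hge u (mem_filter.1 hu).1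
  have h5 := (sum_eq_sum_iff_of_le fun u hu => hge u (mem_filter.1 hu).1).1
    (show ∑ u ∈ W.filter (G.Adj v), 3 = ∑ u ∈ W.filter (G.Adj v), G.degIn W u by omega)
  have hfar : G.farIn W v = ∅ := card_eq_zero.1 (by omega)
  -- If v has degree 5, its neighbours all have degree 3 and everything else is at distance two,
  -- hence adjacent to a vertex of degree 3. Summing gives 16·4 ≤ 58 + 5, which is false.
  have h6 : ∀ w ∈ W, 4 ≤ G.degIn W w + if G.Adj v w then 1 else 0 := by
    intro w hw
    split_ifs with h
    · have := hge w hw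
      omega
    · rcases eq_or_ne w v with rfl | hwv
      · omega
      have hw' : w ∉ G.farIn W v := by rw [hfar]; exact notMem_empty _
      simp only [farIn, mem_filter, not_and, not_forall, not_not] at hw'
      obtain ⟨u, hu, hvu, huw⟩ := hw' hw hwv h
      exact hadj u hu (h5 u (mem_filter.2 ⟨hu, hvu⟩)).symm w hw huw
  have h7 := sum_le_sum h6
  rw [sum_add_distrib, ← card_filter, sum_const, hW] at h7
  change 16 • 4 ≤ G.degSum W + G.degIn W v at h7
  rw [smul_eq_mul] at h7
  omega

/-- Three neighbours of degree 3 would be pairwise nonadjacent; deleting them together with a leaves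
twelve vertices of degree sum 58 - 3·6 - 2 = 38, above the bound 37. -/
theorem degIn_le_two_of_card_eq_sixteen (hG : G.GirthGeFive) {W : Finset V} (hW : #W = 16)
    (h58 : G.degSum W = 58)
    (hadj : ∀ v ∈ W, G.degIn W v = 3 → ∀ u ∈ W, G.Adj v u → 4 ≤ G.degIn W u) {a : V}
    (ha : a ∈ W) (hd : G.degIn W a = 4) :
    G.degIn (W.filter fun v => G.degIn W v = 3) a ≤ 2 := by
  by_contra! h
  obtain ⟨b₁, b₂, b₃, h1, h2, h3, h12, h13, h23⟩ := two_lt_card_iff.1 h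
  simp only [mem_filter] at h1 h2 h3
  obtain ⟨⟨hb1, hd1⟩, ha1⟩ := h1
  obtain ⟨⟨hb2, hd2⟩, ha2⟩ := h2
  obtain ⟨⟨hb3, hd3⟩, ha3⟩ := h3
  have n21 : ¬ G.Adj b₂ b₁ := fun h => by
    have := hadj b₂ hb2 hd2 b₁ hb1 h
    omega
  have n31 : ¬ G.Adj b₃ b₁ := fun h => by
    have := hadj b₃ hb3 hd3 b₁ hb1 h
    omega
  have n32 : ¬ G.Adj b₃ b₂ := fun h => by
    have := hadj b₃ hb3 hd3 b₂ hb2 h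
    omega
  have m2 : b₂ ∈ W.erase b₁ := mem_erase.2 ⟨h12.symm, hb2⟩
  have m3 : b₃ ∈ (W.erase b₁).erase b₂ :=
    mem_erase.2 ⟨h23.symm, mem_erase.2 ⟨h13.symm, hb3⟩⟩
  have m4 : a ∈ ((W.erase b₁).erase b₂).erase b₃ := by
    simp only [mem_erase]
    exact ⟨ha3.ne, ha2.ne, ha1.ne, ha⟩
  have s1 := degSum_erase (G := G) hb1
  have s2 := degSum_erase (G := G) m2
  have s3 := degSum_erase (G := G) m3
  have s4 := degSum_erase (G := G) m4
  rw [degIn_erase_of_not_adj n21] at s2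
  rw [degIn_erase_of_not_adj n32, degIn_erase_of_not_adj n31] at s3
  have d1 := degIn_erase (G := G) hb1 a
  have d2 := degIn_erase (G := G) m2 a
  have d3 := degIn_erase (G := G) m3 a
  rw [if_pos ha1] at d1
  rw [if_pos ha2] at d2
  rw [if_pos ha3] at d3
  have := degSum_le_of_card_eq_twelve hG (W := (((W.erase b₁).erase b₂).erase b₃).erase a)
    (by rw [card_erase_of_mem m4, card_erase_of_mem m3, card_erase_of_mem m2,
      card_erase_of_mem hb1, hW])
  omega

/-- The ten vertices of degree 4 split by their number of neighbours in the independent six-set B: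
two have one (`A₁`), eight have two (`A₂`). The two of `A₁` turn out to be adjacent, so at most four
vertices of `A₂` are attached to them; the others form an independent set of size at least four that
sends too many edges to those four. -/
theorem degSum_le_of_card_eq_sixteen (hG : G.GirthGeFive) {W : Finset V} (hW : #W = 16) :
    G.degSum W ≤ 57 := by
  by_contra! hlt
  obtain ⟨h58, h34, hadj⟩ := three_or_four_of_card_eq_sixteen hG hW hlt
  have hle2 := fun a (ha : a ∈ W) hd => degIn_le_two_of_card_eq_sixteen hG hW h58 hadj ha hd
  obtain ⟨hsum, hcard⟩ := card_filter_degIn h34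
  have hdeg := degIn_eq_add_of_three_or_four (G := G) h34
  have hnb := sum_degIn_neighbors_of_three_or_four (G := G) h34
  set A := W.filter fun v => G.degIn W v = 4 with hA
  set B := W.filter fun v => G.degIn W v = 3 with hB
  have hA10 : #A = 10 := by omega
  have hB6 : #B = 6 := by omega
  have hAB : ∀ a ∈ A, a ∉ B := by
    intro a ha hb
    have := (mem_filter.1 ha).2
    have := (mem_filter.1 hb).2
    omega
  have hBA : ∀ b ∈ B, G.degIn A b = 3 := by
    intro b hb
    have h1 : G.degIn B b = 0 := by
      refine card_eq_zero.2 (filter_eq_empty_iff.2 fun u hu h => ?_)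
      have h1 := hadj b (mem_filter.1 hb).1 (mem_filter.1 hb).2 u (mem_filter.1 hu).1 h
      have h2 := (mem_filter.1 hu).2
      omega
    have h2 := hdeg b
    rw [(mem_filter.1 hb).2] at h2
    omega
  have ha12 : ∀ a ∈ A, G.degIn B a = 1 ∨ G.degIn B a = 1 + 1 := by
    intro a ha
    rw [hA, mem_filter] at ha
    have h1 := sum_degIn_neighbors_add_card_farIn_le hG ha.1
    rw [hnb] at h1
    have h2 := hle2 a ha.1 ha.2
    have h3 := hdeg a
    omega
  have h18 : ∑ a ∈ A, G.degIn B a = 18 := by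
    rw [sum_degIn_comm, sum_congr rfl hBA, sum_const, hB6]
    rfl
  set A₁ := A.filter fun a => G.degIn B a = 1 with hA1
  set A₂ := A.filter fun a => G.degIn B a = 1 + 1 with hA2
  have hA2c : #A₂ = 8 := by
    have := sum_eq_of_two_values ha12
    change _ = 1 * #A + #A₂ at this
    omega
  have hdisj : Disjoint A₁ A₂ := by
    rw [Finset.disjoint_left]
    intro v h1 h2
    simp only [hA1, hA2, mem_filter] at h1 h2
    omega
  have hunion : A = A₁ ∪ A₂ := by
    ext v
    simp only [hA1, hA2, mem_union, mem_filter]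
    have := ha12 v
    tauto
  have hA1c : #A₁ = 2 := by
    have := card_union_of_disjoint hdisj
    rw [← hunion] at this
    omega
  have hdegA : ∀ a, G.degIn A a = G.degIn A₁ a + G.degIn A₂ a := fun a => by
    conv_lhs => rw [hunion]
    exact degIn_union hdisj a
  have hA1deg : ∀ a ∈ A₁, G.degIn A a = 3 := fun a ha => by
    have h1 := hdeg a
    rw [hA1, mem_filter] at ha
    rw [ha.2, (mem_filter.1 ha.1).2] at h1
    omega
  have hA2deg : ∀ a ∈ A₂, G.degIn A a = 2 := fun a ha => by
    have h1 := hdeg a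
    rw [hA2, mem_filter] at ha
    rw [ha.2, (mem_filter.1 ha.1).2] at h1
    omega
  have hA1A : ∀ a ∈ A₁, a ∈ A := fun a ha => (mem_filter.1 ha).1
  have hA2A : ∀ a ∈ A₂, a ∈ A := fun a ha => (mem_filter.1 ha).1
  have hA1nb : ∀ v ∈ A₁, ∃ u ∈ A₁, G.Adj v u := by
    intro v hv
    by_contra! h
    have hv' := (mem_filter.1 hv)
    obtain ⟨b, hb⟩ : (B.filter (G.Adj v)).Nonempty := card_pos.1 (by
      change 0 < G.degIn B v
      omega)
    rw [mem_filter] at hb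
    set N := A.filter (G.Adj v) with hN
    have hNA2 : ∀ u ∈ N, u ∈ A₂ := fun u hu => by
      rw [hN, mem_filter] at hu
      rw [hunion, mem_union] at hu
      exact hu.1.resolve_left fun h' => h u h' hu.2
    have hd : (N : Set V).PairwiseDisjoint fun u => B.filter (G.Adj u) := by
      intro u hu u' hu' hne
      have hu1 := (mem_filter.1 hu)
      have hu2 := (mem_filter.1 hu')
      exact disjoint_filter_adj_of_common hG hne hu1.2.symm hu2.2 (hAB v hv'.1)
    -- Three disjoint pairs would have to fit into the five elements of B other than the neighbour b
    -- of v.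
    have hsub : (N.biUnion fun u => B.filter (G.Adj u)) ⊆ B.erase b := by
      intro x hx
      simp only [mem_biUnion, mem_filter] at hx
      obtain ⟨u, hu, hxB, hux⟩ := hx
      refine mem_erase.2 ⟨?_, hxB⟩
      rintro rfl
      exact hG.triangle_free (mem_filter.1 hu).2 hux hb.2
    have h1 := card_le_card hsub
    rw [card_biUnion hd, card_erase_of_mem hb.1, hB6] at h1
    change ∑ u ∈ N, G.degIn B u ≤ 6 - 1 at h1
    rw [sum_congr rfl fun u hu => (mem_filter.1 (hNA2 u hu)).2, sum_const] at h1
    change G.degIn A v • (1 + 1) ≤ 6 - 1 at h1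
    rw [hA1deg v hv, smul_eq_mul] at h1
    omega
  obtain ⟨v₁, hv1⟩ : A₁.Nonempty := card_pos.1 (by omega)
  obtain ⟨v₂, hv2, h12⟩ := hA1nb v₁ hv1
  have hA1eq : {v₁, v₂} = A₁ := eq_of_subset_of_card_le
    (insert_subset hv1 (singleton_subset_iff.2 hv2)) (by rw [hA1c, card_pair h12.ne])
  set D := A₂.filter fun u => G.Adj v₁ u ∨ G.Adj v₂ u with hD
  set I := A₂.filter fun u => ¬ (G.Adj v₁ u ∨ G.Adj v₂ u) with hI
  have hDI : #D + #I = 8 := by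
    rw [← hA2c]
    exact card_filter_add_card_filter_not _
  have hDc : #D ≤ 4 := by
    have h1 : #D ≤ G.degIn A₂ v₁ + G.degIn A₂ v₂ := by
      rw [hD, filter_or]
      exact card_union_le _ _
    have h2 := hdegA v₁
    have h3 := hdegA v₂
    rw [hA1deg _ hv1] at h2
    rw [hA1deg _ hv2] at h3
    have h4 : 0 < G.degIn A₁ v₁ := card_pos.2 ⟨v₂, mem_filter.2 ⟨hv2, h12⟩⟩
    have h5 : 0 < G.degIn A₁ v₂ := card_pos.2 ⟨v₁, mem_filter.2 ⟨hv1, h12.symm⟩⟩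
    omega
  have hIdeg : ∀ u ∈ I, G.degIn A₂ u = 2 := fun u hu => by
    rw [hI, mem_filter] at hu
    have h1 : G.degIn A₁ u = 0 := by
      refine card_eq_zero.2 (filter_eq_empty_iff.2 fun x hx h => hu.2 ?_)
      rw [← hA1eq, mem_insert, mem_singleton] at hx
      rcases hx with rfl | rfl
      · exact Or.inl h.symm
      · exact Or.inr h.symm
    have h2 := hdegA u
    rw [hA2deg u hu.1] at h2
    omega
  have hDdeg : ∀ w ∈ D, G.degIn A₂ w ≤ 1 := fun w hw => by
    rw [hD, mem_filter] at hw
    have h1 : 0 < G.degIn A₁ w := by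
      refine card_pos.2 ?_
      rcases hw.2 with h | h
      · exact ⟨v₁, mem_filter.2 ⟨hv1, h.symm⟩⟩
      · exact ⟨v₂, mem_filter.2 ⟨hv2, h.symm⟩⟩
    have h2 := hdegA w
    rw [hA2deg w hw.1] at h2
    omega
  have hII : ∀ u ∈ I, ∀ w ∈ I, ¬ G.Adj u w := by
    intro u hu w hw h
    -- An edge inside I extends at both ends to a path on four vertices of `A₂`, each with two
    -- neighbours in B.
    have hu2 := (mem_filter.1 hu).1
    have hw2 := (mem_filter.1 hw).1
    obtain ⟨s, hs, hsw⟩ := exists_mem_ne (show 1 < #(A₂.filter (G.Adj u)) by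
      have := hIdeg u hu
      change 1 < G.degIn A₂ u
      omega) w
    obtain ⟨p, hp, hpu⟩ := exists_mem_ne (show 1 < #(A₂.filter (G.Adj w)) by
      have := hIdeg w hw
      change 1 < G.degIn A₂ w
      omega) u
    rw [mem_filter] at hs hp
    exact false_of_path_of_two_neighbors hG hB6 (mem_filter.1 hp.1).2 (mem_filter.1 hw2).2
      (mem_filter.1 hu2).2 (mem_filter.1 hs.1).2 (hAB _ (hA2A _ hw2)) (hAB _ (hA2A _ hu2)) hpu
      hsw.symm hp.2.symm h.symm hs.2
  have hID : ∀ u ∈ I, G.degIn D u = 2 := fun u hu => by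
    rw [← hIdeg u hu]
    unfold degIn
    congr 1
    ext x
    simp only [hD, mem_filter]
    constructor
    · rintro ⟨⟨h1, -⟩, h2⟩
      exact ⟨h1, h2⟩
    · rintro ⟨h1, h2⟩
      refine ⟨⟨h1, ?_⟩, h2⟩
      by_contra h3
      exact hII u hu x (mem_filter.2 ⟨h1, h3⟩) h2
  have h1 : ∑ w ∈ D, G.degIn I w ≤ #D • 1 := sum_le_card_nsmul _ _ _ fun w hw =>
    (degIn_mono (filter_subset _ _) w).trans (hDdeg w hw)
  rw [← sum_degIn_comm, sum_congr rfl hID, sum_const, smul_eq_mul, smul_eq_mul] at h1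
  omega

/-- Graphs of girth at least five with at most sixteen vertices have at most `2 n - 4` edges. -/
theorem degSum_add_six_lt (hG : G.GirthGeFive) {W : Finset V} (h3 : 3 ≤ #W) (h16 : #W ≤ 16) :
    G.degSum W + 6 < 4 * #W := by
  -- Up to thirteen vertices Cauchy–Schwarz suffices: (4n - 6)² + n² > n³.
  rcases le_or_gt #W 13 with h | h
  · have := degSum_sq_le hG W
    by_contra! hlt
    interval_cases #W <;> nlinarith
  · have h4 := fun h => degSum_le_of_card_eq_fourteen hG (W := W) h
    have h5 := fun h => degSum_le_of_card_eq_fifteen hG (W := W) h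
    have h6 := fun h => degSum_le_of_card_eq_sixteen hG (W := W) h
    omega

/-- Graphs of girth at least five with `n ∈ {4, 6, 8, 10, 12, 14}` vertices have at most `2 n - 5`
edges. -/
theorem degSum_add_eight_lt (hG : G.GirthGeFive) {W : Finset V} (h4 : 4 ≤ #W) (h14 : #W ≤ 14)
    (hev : Even #W) : G.degSum W + 8 < 4 * #W := by
  rcases le_or_gt #W 12 with h | h
  · have := degSum_sq_le hG W
    by_contra! hlt
    interval_cases #W <;> first | (exfalso; revert hev; decide) | nlinarith
  · have h5 : #W = 14 := by
      obtain ⟨k, hk⟩ := hev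
      omega
    have := degSum_le_of_card_eq_fourteen hG h5
    omega

end Sixteen

end SimpleGraph

/-! ### Spreading of information along a sequence of calls -/

namespace Gossip

open Finset

section Informs

variable {V : Type*}

/-- In the sequence `L` of calls, in chronological order, the information of `u` reaches `v`. -/
def Informs : List (V × V) → V → V → Prop
  | [], u, v => u = v
  | c :: L, u, v => Informs L u v ∨ (u = c.1 ∧ Informs L c.2 v) ∨ (u = c.2 ∧ Informs L c.1 v)

theorem informs_append {L₁ L₂ : List (V × V)} {u v : V} :
    Informs (L₁ ++ L₂) u v ↔ ∃ w, Informs L₁ u w ∧ Informs L₂ w v := by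
  induction L₁ generalizing u with
  | nil => simp [Informs]
  | cons c L ih =>
    simp only [List.cons_append, Informs, ih]
    constructor
    · rintro (⟨w, h1, h2⟩ | ⟨rfl, w, h1, h2⟩ | ⟨rfl, w, h1, h2⟩)
      · exact ⟨w, Or.inl h1, h2⟩
      · exact ⟨w, Or.inr (Or.inl ⟨rfl, h1⟩), h2⟩
      · exact ⟨w, Or.inr (Or.inr ⟨rfl, h1⟩), h2⟩
    · rintro ⟨w, h1 | ⟨rfl, h1⟩ | ⟨rfl, h1⟩, h2⟩
      · exact Or.inl ⟨w, h1, h2⟩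
      · exact Or.inr (Or.inl ⟨rfl, w, h1, h2⟩)
      · exact Or.inr (Or.inr ⟨rfl, w, h1, h2⟩)

theorem informs_concat {L : List (V × V)} {a b u v : V} :
    Informs (L ++ [(a, b)]) u v ↔
      Informs L u v ∨ (v = a ∧ Informs L u b) ∨ (v = b ∧ Informs L u a) := by
  simp only [informs_append, Informs]
  constructor
  · rintro ⟨w, h, rfl | ⟨rfl, rfl⟩ | ⟨rfl, rfl⟩⟩
    · exact Or.inl h
    · exact Or.inr (Or.inr ⟨rfl, h⟩)
    · exact Or.inr (Or.inl ⟨rfl, h⟩)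
  · rintro (h | ⟨rfl, h⟩ | ⟨rfl, h⟩)
    · exact ⟨v, h, Or.inl rfl⟩
    · exact ⟨b, h, Or.inr (Or.inr ⟨rfl, rfl⟩)⟩
    · exact ⟨a, h, Or.inr (Or.inl ⟨rfl, rfl⟩)⟩

theorem informs_concat_left {L : List (V × V)} {a b u : V} :
    Informs (L ++ [(a, b)]) u a ↔ Informs L u a ∨ Informs L u b := by
  rw [informs_concat]
  constructor
  · rintro (h | ⟨-, h⟩ | ⟨rfl, h⟩)
    exacts [Or.inl h, Or.inr h, Or.inl h]
  · rintro (h | h)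
    exacts [Or.inl h, Or.inr (Or.inl ⟨rfl, h⟩)]

theorem informs_concat_right {L : List (V × V)} {a b u : V} :
    Informs (L ++ [(a, b)]) u b ↔ Informs L u a ∨ Informs L u b := by
  rw [informs_concat]
  constructor
  · rintro (h | ⟨rfl, h⟩ | ⟨-, h⟩)
    exacts [Or.inr h, Or.inr h, Or.inl h]
  · rintro (h | h)
    exacts [Or.inr (Or.inr ⟨rfl, h⟩), Or.inl h]

theorem informs_concat_of_ne {L : List (V × V)} {a b u v : V} (ha : v ≠ a) (hb : v ≠ b) :
    Informs (L ++ [(a, b)]) u v ↔ Informs L u v := by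
  simp [informs_concat, ha, hb]

/-- Chains of calls can be read backwards; this is the duality between senders and receivers. -/
theorem informs_reverse {L : List (V × V)} {u v : V} :
    Informs L.reverse u v ↔ Informs L v u := by
  induction L generalizing v with
  | nil => exact eq_comm
  | cons c L ih =>
    rw [List.reverse_cons, ← Prod.mk.eta (p := c), informs_concat]
    simp only [Informs, ih]

/-- A call commutes with calls that involve neither of its participants. -/
theorem informs_cons_iff_concat {L : List (V × V)} {a b u v : V}
    (h : ∀ x ∈ L, x.1 ≠ a ∧ x.1 ≠ b ∧ x.2 ≠ a ∧ x.2 ≠ b) :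
    Informs ((a, b) :: L) u v ↔ Informs (L ++ [(a, b)]) u v := by
  induction L generalizing u with
  | nil => simp
  | cons c L ih =>
    have ih' := fun u => ih (u := u) fun x hx => h x (List.mem_cons_of_mem _ hx)
    obtain ⟨h1, h2, h3, h4⟩ := h c List.mem_cons_self
    simp only [List.cons_append, Informs, ← ih']
    grind

theorem informs_middle_iff {L₁ L₂ : List (V × V)} {a b u v : V}
    (h : ∀ x ∈ L₂, x.1 ≠ a ∧ x.1 ≠ b ∧ x.2 ≠ a ∧ x.2 ≠ b) :
    Informs (L₁ ++ (a, b) :: L₂) u v ↔ Informs ((L₁ ++ L₂) ++ [(a, b)]) u v := by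
  rw [List.append_assoc, informs_append, informs_append]
  simp only [informs_cons_iff_concat h]

/-- Every call enlarges the set of informed persons by at most one. -/
theorem exists_card_le_of_informs [DecidableEq V] (L : List (V × V)) (A : Finset V) :
    ∃ B : Finset V, #B ≤ L.length + #A ∧ ∀ u ∈ A, ∀ v, Informs L u v → v ∈ B := by
  induction L using List.reverseRecOn with
  | nil => exact ⟨A, by simp, fun u hu v h => (h : u = v) ▸ hu⟩
  | append_singleton L c ih =>
    obtain ⟨a, b⟩ := c
    obtain ⟨B, hB, h⟩ := ih
    have key : ∀ x y, (x = a ∧ y = b ∨ x = b ∧ y = a) → x ∈ B →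
        ∃ B' : Finset V, #B' ≤ (L ++ [(a, b)]).length + #A ∧
          ∀ u ∈ A, ∀ v, Informs (L ++ [(a, b)]) u v → v ∈ B' := by
      intro x y hxy hx
      refine ⟨insert y B, (card_insert_le _ _).trans ?_, fun u hu v huv => ?_⟩
      · rw [List.length_append, List.length_singleton]
        omega
      · rw [informs_concat] at huv
        rw [mem_insert]
        rcases huv with huv | ⟨rfl, -⟩ | ⟨rfl, -⟩
        · exact Or.inr (h u hu v huv)
        · rcases hxy with ⟨rfl, -⟩ | ⟨-, rfl⟩
          exacts [Or.inr hx, Or.inl rfl]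
        · rcases hxy with ⟨-, rfl⟩ | ⟨rfl, -⟩
          exacts [Or.inl rfl, Or.inr hx]
    by_cases ha : a ∈ B
    · exact key a b (Or.inl ⟨rfl, rfl⟩) ha
    by_cases hb : b ∈ B
    · exact key b a (Or.inr ⟨rfl, rfl⟩) hb
    refine ⟨B, ?_, fun u hu v huv => ?_⟩
    · rw [List.length_append, List.length_singleton]
      omega
    · rw [informs_concat] at huv
      rcases huv with huv | ⟨rfl, huv⟩ | ⟨rfl, huv⟩
      · exact h u hu v huv
      · exact absurd (h u hu _ huv) hb
      · exact absurd (h u hu _ huv) ha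

end Informs

/-! ### Schemes with pooled pairs, and the reduction to irreducible ones -/

section Scheme

variable {V : Type*}

/-- The unordered pairs underlying a sequence of calls. -/
def edges (L : List (V × V)) : List (Sym2 V) := L.map fun c => s(c.1, c.2)

/-- The information of every member of `P` reaches `v`. -/
def Expert (L : List (V × V)) (P : Finset (Sym2 V)) (v : V) : Prop :=
  ∀ e ∈ P, ∃ u ∈ e, Informs L u v

/-- A family of pairwise disjoint one- or two-element sets. -/
def IsMatching (P : Finset (Sym2 V)) : Prop :=
  ∀ e ∈ P, ∀ f ∈ P, ∀ v, v ∈ e → v ∈ f → e = f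

/-- A sequence `L` of calls informing all members of `X` about all members of `P`, where the
members of `P` and `X` are single persons or pairs sharing their information. The calls and the
pairs are distinct edges of the graph `G`. -/
structure Scheme (G : SimpleGraph V) (L : List (V × V)) (P X : Finset (Sym2 V)) : Prop where
  nodup : (edges L).Nodup
  adj : ∀ c ∈ L, G.Adj c.1 c.2
  left_edge : ∀ e ∈ P, ¬ e.IsDiag → e ∈ G.edgeSet
  right_edge : ∀ e ∈ X, ¬ e.IsDiag → e ∈ G.edgeSet
  left_notMem : ∀ e ∈ P, e ∉ edges L
  right_notMem : ∀ e ∈ X, e ∉ edges L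
  isDiag : ∀ e ∈ P, e ∈ X → e.IsDiag
  left_matching : IsMatching P
  right_matching : IsMatching X
  informs : ∀ e ∈ P, ∀ f ∈ X, ∃ u ∈ e, ∃ v ∈ f, Informs L u v

theorem edges_reverse (L : List (V × V)) : edges L.reverse = (edges L).reverse :=
  List.map_reverse

variable {G : SimpleGraph V} {L : List (V × V)} {P X : Finset (Sym2 V)}

theorem Scheme.reverse (h : Scheme G L P X) : Scheme G L.reverse X P where
  nodup := by
    rw [edges_reverse]
    exact List.nodup_reverse.2 h.nodup
  adj c hc := h.adj c (List.mem_reverse.1 hc)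
  left_edge := h.right_edge
  right_edge := h.left_edge
  left_notMem e he := by
    rw [edges_reverse, List.mem_reverse]
    exact h.right_notMem e he
  right_notMem e he := by
    rw [edges_reverse, List.mem_reverse]
    exact h.left_notMem e he
  isDiag e he he' := h.isDiag e he' he
  left_matching := h.right_matching
  right_matching := h.left_matching
  informs e he f hf := by
    obtain ⟨u, hu, v, hv, huv⟩ := h.informs f hf e he
    exact ⟨v, hv, u, hu, informs_reverse.2 huv⟩

/-- Work from the end. If the participants of the final call are not experts after it, every expert
was one before it, and the experts of the call found earlier take no part in it. Two disjoint
senders are needed so that nobody is an expert without calls. -/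
theorem exists_last_call_of_expert (hP : IsMatching P) (hP2 : 1 < #P) {v : V}
    (hv : Expert L P v) : ∃ L₁ a b L₂, L = L₁ ++ (a, b) :: L₂ ∧
      (∀ x ∈ L₂, x.1 ≠ a ∧ x.1 ≠ b ∧ x.2 ≠ a ∧ x.2 ≠ b) ∧ Expert L P a := by
  induction L using List.reverseRecOn generalizing v with
  | nil =>
    obtain ⟨e, he, f, hf, hef⟩ := one_lt_card.1 hP2
    obtain ⟨u, hu, huv⟩ := hv e he
    obtain ⟨w, hw, hwv⟩ := hv f hf
    change u = v at huv
    change w = v at hwv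
    subst huv hwv
    exact absurd (hP e he f hf _ hu hw) hef
  | append_singleton L c ih =>
    obtain ⟨a, b⟩ := c
    by_cases hab : Expert (L ++ [(a, b)]) P a
    · exact ⟨L, a, b, [], rfl, by simp, hab⟩
    have hb : ¬ Expert (L ++ [(a, b)]) P b := fun h => hab fun e he => by
      obtain ⟨u, hu, hub⟩ := h e he
      exact ⟨u, hu, informs_concat_left.2 (informs_concat_right.1 hub)⟩
    have hne : ∀ w, Expert (L ++ [(a, b)]) P w → w ≠ a ∧ w ≠ b := fun w hw =>
      ⟨fun h => hab (h ▸ hw), fun h => hb (h ▸ hw)⟩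
    have hv' : Expert L P v := fun e he => by
      obtain ⟨u, hu, huv⟩ := hv e he
      exact ⟨u, hu, (informs_concat_of_ne (hne v hv).1 (hne v hv).2).1 huv⟩
    obtain ⟨L₁, c, d, L₂, rfl, h2, hc⟩ := ih hv'
    have hmono : ∀ w, Expert (L₁ ++ (c, d) :: L₂) P w →
        Expert (L₁ ++ (c, d) :: L₂ ++ [(a, b)]) P w := fun w hw e he => by
      obtain ⟨u, hu, huw⟩ := hw e he
      exact ⟨u, hu, informs_concat.2 (Or.inl huw)⟩
    have hd : Expert (L₁ ++ (c, d) :: L₂) P d := fun e he => by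
      obtain ⟨u, hu, huc⟩ := hc e he
      rw [informs_middle_iff h2] at huc
      exact ⟨u, hu, (informs_middle_iff h2).2
        (informs_concat_right.2 (informs_concat_left.1 huc))⟩
    have h3 := hne c (hmono c hc)
    have h4 := hne d (hmono d hd)
    refine ⟨L₁, c, d, L₂ ++ [(a, b)], by simp, fun x hx => ?_, hmono c hc⟩
    rcases List.mem_append.1 hx with hx | hx
    · exact h2 x hx
    · obtain rfl := List.mem_singleton.1 hx
      exact ⟨h3.1.symm, h4.1.symm, h3.2.symm, h4.2.symm⟩

/-- If some person knows everything, the last call of such a person can be turned into a pair of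
receivers. -/
theorem Scheme.exists_of_expert [DecidableEq V] (h : Scheme G L P X) (hP : 1 < #P) {v : V}
    (hv : Expert L P v) : ∃ L' X', Scheme G L' P X' ∧ L'.length + 1 = L.length ∧
      #X ≤ #X' + 1 ∧ X'.Nonempty := by
  obtain ⟨L₁, a, b, L₂, rfl, h2, ha⟩ := exists_last_call_of_expert h.left_matching hP hv
  have hnd := h.nodup
  have hedges : (edges (L₁ ++ (a, b) :: L₂)).Perm (s(a, b) :: edges (L₁ ++ L₂)) := by
    simp only [edges, List.map_append, List.map_cons]
    exact List.perm_middle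
  rw [hedges.nodup_iff, List.nodup_cons] at hnd
  have hab : G.Adj a b := h.adj (a, b) (by simp)
  have hmem : ∀ e, e ∈ edges (L₁ ++ (a, b) :: L₂) ↔ e = s(a, b) ∨ e ∈ edges (L₁ ++ L₂) :=
    fun e => by rw [hedges.mem_iff, List.mem_cons]
  -- The call ab can be postponed to the end, where only the at most two receivers meeting {a, b}
  -- depend on it; they give way to the one pair {a, b}.
  set Y := X.filter fun e => a ∉ e ∧ b ∉ e with hY
  have hYX : ∀ e ∈ Y, e ∈ X := fun e he => (mem_filter.1 he).1
  have habY : s(a, b) ∉ Y := fun h => (mem_filter.1 h).2.1 (Sym2.mem_mk_left _ _)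
  have hcard : #X ≤ #Y + 2 := by
    have h1 : ∀ w, #(X.filter fun e => w ∈ e) ≤ 1 := fun w => by
      refine card_le_one.2 fun e he f hf => ?_
      rw [mem_filter] at he hf
      exact h.right_matching e he.1 f hf.1 w he.2 hf.2
    have h3 : X ⊆ Y ∪ (X.filter (fun e => a ∈ e) ∪ X.filter fun e => b ∈ e) := fun e he => by
      simp only [hY, mem_union, mem_filter]
      tauto
    have h4 := card_le_card h3
    have h5 := card_union_le Y (X.filter (fun e => a ∈ e) ∪ X.filter fun e => b ∈ e)
    have h6 := card_union_le (X.filter (fun e => a ∈ e)) (X.filter fun e => b ∈ e)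
    have := h1 a
    have := h1 b
    omega
  refine ⟨L₁ ++ L₂, insert s(a, b) Y, ?_, by simp; omega, ?_, insert_nonempty _ _⟩
  · exact
    { nodup := hnd.2
      adj := fun c hc => h.adj c (by
        rw [List.mem_append] at hc ⊢
        exact hc.imp_right (List.mem_cons_of_mem _))
      left_edge := h.left_edge
      right_edge := fun e he hd => by
        rcases mem_insert.1 he with rfl | he
        · exact hab
        · exact h.right_edge e (hYX e he) hd
      left_notMem := fun e he he' => h.left_notMem e he ((hmem e).2 (Or.inr he'))
      right_notMem := fun e he he' => by
        rcases mem_insert.1 he with rfl | he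
        · exact hnd.1 he'
        · exact h.right_notMem e (hYX e he) ((hmem e).2 (Or.inr he'))
      isDiag := fun e he he' => by
        rcases mem_insert.1 he' with rfl | he'
        · exact absurd ((hmem _).2 (Or.inl rfl)) (h.left_notMem _ he)
        · exact h.isDiag e he (hYX e he')
      left_matching := h.left_matching
      right_matching := fun e he f hf w hwe hwf => by
        have key : ∀ e ∈ Y, w ∈ e → w ∈ s(a, b) → False := fun e he hwe hw => by
          have := (mem_filter.1 he).2
          rcases Sym2.mem_iff.1 hw with rfl | rfl
          exacts [this.1 hwe, this.2 hwe]
        rcases mem_insert.1 he with rfl | he <;> rcases mem_insert.1 hf with rfl | hf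
        · rfl
        · exact (key f hf hwf hwe).elim
        · exact (key e he hwe hwf).elim
        · exact h.right_matching e (hYX e he) f (hYX f hf) w hwe hwf
      informs := fun e he f hf => by
        rcases mem_insert.1 hf with rfl | hf
        · obtain ⟨u, hu, hua⟩ := ha e he
          rw [informs_middle_iff h2, informs_concat_left] at hua
          rcases hua with hua | hub
          · exact ⟨u, hu, a, Sym2.mem_mk_left _ _, hua⟩
          · exact ⟨u, hu, b, Sym2.mem_mk_right _ _, hub⟩
        · obtain ⟨u, hu, w, hw, huv⟩ := h.informs e he f (hYX f hf)
          have := (mem_filter.1 hf).2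
          rw [informs_middle_iff h2, informs_concat_of_ne (by rintro rfl; exact this.1 hw)
            (by rintro rfl; exact this.2 hw)] at huv
          exact ⟨u, hu, w, hw, huv⟩ }
  · rw [card_insert_of_notMem habY]
    omega

/-- One sender starts with at most two informed persons, and disjoint receivers need distinct
informed persons. This is the base case of the induction. -/
theorem Scheme.card_right_le [DecidableEq V] (h : Scheme G L P X) {e : Sym2 V} (he : e ∈ P) :
    #X ≤ L.length + 2 := by
  obtain ⟨B, hB, hi⟩ := exists_card_le_of_informs L e.toFinset
  have he2 : #e.toFinset ≤ 2 := by
    rw [Sym2.card_toFinset]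
    split_ifs <;> norm_num
  have hB' : ∀ f ∈ X, ∃ v ∈ f, v ∈ B := fun f hf => by
    obtain ⟨u, hu, v, hv, huv⟩ := h.informs e he f hf
    exact ⟨v, hv, hi u (Sym2.mem_toFinset.2 hu) v huv⟩
  have : Nonempty V := ⟨e.out.1⟩
  choose! g hg hgB using hB'
  have : #X ≤ #B := card_le_card_of_injOn g hgB fun e he f hf hef =>
    h.right_matching e he f hf (g e) (hg e he) (hef ▸ hg f hf)
  omega

/-- Induction on the number of calls: it suffices to treat schemes in which nobody knows
everything and nobody informs everybody. -/
theorem Scheme.card_add_card_le_of_irreducible [DecidableEq V]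
    (H : ∀ L P X, Scheme G L P X → P.Nonempty → X.Nonempty → (∀ v, ¬ Expert L P v) →
      (∀ v, ¬ Expert L.reverse X v) → #P + #X ≤ L.length + 3)
    (h : Scheme G L P X) (hP : P.Nonempty) (hX : X.Nonempty) : #P + #X ≤ L.length + 3 := by
  induction hn : L.length using Nat.strong_induction_on generalizing L P X with
  | _ n ih =>
    subst hn
    rcases (Nat.succ_le_of_lt hP.card_pos).eq_or_lt' with h1 | hP1
    · obtain ⟨e, he⟩ := hP
      have := h.card_right_le he
      omega
    rcases (Nat.succ_le_of_lt hX.card_pos).eq_or_lt' with h1 | hX1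
    · obtain ⟨e, he⟩ := hX
      have := h.reverse.card_right_le he
      rw [List.length_reverse] at this
      omega
    by_cases hE : ∃ v, Expert L P v
    · obtain ⟨v, hv⟩ := hE
      obtain ⟨L', X', h', hL', hX', hne⟩ := h.exists_of_expert hP1 hv
      have := ih L'.length (by omega) h' hP hne rfl
      omega
    by_cases hB : ∃ v, Expert L.reverse X v
    · obtain ⟨v, hv⟩ := hB
      obtain ⟨L', P', h', hL', hP', hne⟩ := h.reverse.exists_of_expert hX1 hv
      rw [List.length_reverse] at hL'
      have := ih L'.length (by omega) h' hX hne rfl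
      omega
    push Not at hE hB
    exact H L P X h hP hX hE hB

end Scheme

end Gossip

/-! ### Components and cycles of the call graph -/

namespace Gossip

open Finset

section Label

variable {V : Type*} [DecidableEq V]

/-- A representative of the connected component of `v` in the graph formed by the calls. -/
def label (L : List (V × V)) : V → V :=
  L.foldl (fun φ c v => if φ v = φ c.2 then φ c.1 else φ v) id

theorem label_concat (L : List (V × V)) (a b v : V) :
    label (L ++ [(a, b)]) v = if label L v = label L b then label L a else label L v := by
  rw [label, List.foldl_append]
  rfl

theorem label_concat_congr {L : List (V × V)} {u v : V} (c : V × V) (h : label L u = label L v) :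
    label (L ++ [c]) u = label (L ++ [c]) v := by
  rw [← Prod.mk.eta (p := c), label_concat, label_concat, h]

theorem label_concat_edge (L : List (V × V)) (a b : V) :
    label (L ++ [(a, b)]) a = label (L ++ [(a, b)]) b := by
  simp [label_concat]

theorem label_eq_of_mem {L : List (V × V)} {c : V × V} (h : c ∈ L) :
    label L c.1 = label L c.2 := by
  induction L using List.reverseRecOn with
  | nil => simp at h
  | append_singleton L d ih =>
    rcases List.mem_append.1 h with h | h
    · exact label_concat_congr _ (ih h)
    · rw [List.mem_singleton] at h
      subst h
      exact label_concat_edge L c.1 c.2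

theorem Informs.label_eq {L : List (V × V)} {u v : V} (h : Informs L u v) :
    label L u = label L v := by
  induction L using List.reverseRecOn generalizing v with
  | nil => exact congrArg _ h
  | append_singleton L c ih =>
    obtain ⟨a, b⟩ := c
    rcases informs_concat.1 h with h' | ⟨rfl, h'⟩ | ⟨rfl, h'⟩
    · exact label_concat_congr _ (ih h')
    · exact (label_concat_congr _ (ih h')).trans (label_concat_edge L _ b).symm
    · exact (label_concat_congr _ (ih h')).trans (label_concat_edge L a _)

variable [Fintype V]

/-- The number of connected components of the graph formed by the calls. -/
def numComp (L : List (V × V)) : ℕ := #(univ.image (label L))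

theorem numComp_concat_of_eq {L : List (V × V)} {a b : V} (h : label L a = label L b) :
    numComp (L ++ [(a, b)]) = numComp L := by
  have : label (L ++ [(a, b)]) = label L := by
    funext v
    rw [label_concat, h]
    split_ifs with h'
    exacts [h'.symm, rfl]
  rw [numComp, this, numComp]

theorem numComp_concat_of_ne {L : List (V × V)} {a b : V} (h : label L a ≠ label L b) :
    numComp (L ++ [(a, b)]) + 1 = numComp L := by
  have : univ.image (label (L ++ [(a, b)])) = (univ.image (label L)).erase (label L b) := by
    ext y
    simp only [mem_image, mem_univ, true_and, mem_erase, label_concat]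
    constructor
    · rintro ⟨v, rfl⟩
      split_ifs with hv
      exacts [⟨h, a, rfl⟩, ⟨hv, v, rfl⟩]
    · rintro ⟨hy, v, rfl⟩
      exact ⟨v, if_neg hy⟩
  rw [numComp, this, numComp]
  exact card_erase_add_one (mem_image_of_mem _ (mem_univ b))

theorem card_le_length_add_numComp (L : List (V × V)) :
    Fintype.card V ≤ L.length + numComp L := by
  induction L using List.reverseRecOn with
  | nil => simp [numComp, label, card_univ]
  | append_singleton L c ih =>
    obtain ⟨a, b⟩ := c
    rw [List.length_append, List.length_singleton]
    by_cases h : label L a = label L b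
    · rw [numComp_concat_of_eq h]
      omega
    · have := numComp_concat_of_ne h
      omega

/-- In a forest of calls two persons informing each other have a call. -/
theorem exists_mem_of_informs_of_informs {L : List (V × V)}
    (hL : L.length + numComp L ≤ Fintype.card V) {u v : V} (huv : u ≠ v) (h1 : Informs L u v)
    (h2 : Informs L v u) : (u, v) ∈ L ∨ (v, u) ∈ L := by
  induction L using List.reverseRecOn with
  | nil => exact absurd h1 huv
  | append_singleton L c ih =>
    obtain ⟨a, b⟩ := c
    rw [List.length_append, List.length_singleton] at hL
    have hc := card_le_length_add_numComp L
    have hab : label L a ≠ label L b := fun h => by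
      rw [numComp_concat_of_eq h] at hL
      omega
    have hn := numComp_concat_of_ne hab
    have ih' := ih (by omega)
    suffices h : (Informs L u v ∧ Informs L v u) ∨ (u = a ∧ v = b) ∨ (u = b ∧ v = a) by
      rcases h with h | ⟨rfl, rfl⟩ | ⟨rfl, rfl⟩
      · exact (ih' h.1 h.2).imp (List.mem_append_left _) (List.mem_append_left _)
      · simp
      · simp
    -- The last call joins two components. If x needs it to reach y, then x and y were separated
    -- before it, so y also reaches x only by this call, and {x, y} = {a, b}.
    have key : ∀ x y, x ≠ y → Informs (L ++ [(a, b)]) x y → Informs (L ++ [(a, b)]) y x →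
        (x = a → y ≠ b) → (x = b → y ≠ a) → Informs L x y := by
      intro x y hxy k1 k2 hxa hxb
      rw [informs_concat] at k1 k2
      rcases k1 with k1 | ⟨rfl, k1⟩ | ⟨rfl, k1⟩
      · exact k1
      · have hxb' : x ≠ b := fun h => hxb h rfl
        rcases k2 with k2 | ⟨rfl, -⟩ | ⟨rfl, -⟩
        · exact absurd (k2.label_eq.trans k1.label_eq) hab
        · exact absurd rfl hxy
        · exact absurd rfl hxb'
      · have hxa' : x ≠ a := fun h => hxa h rfl
        rcases k2 with k2 | ⟨rfl, -⟩ | ⟨rfl, -⟩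
        · exact absurd (k2.label_eq.trans k1.label_eq).symm hab
        · exact absurd rfl hxa'
        · exact absurd rfl hxy
    by_cases hc : (u = a ∧ v = b) ∨ (u = b ∧ v = a)
    · exact Or.inr hc
    · exact Or.inl ⟨key u v huv h1 h2 (by tauto) (by tauto),
        key v u huv.symm h2 h1 (by tauto) (by tauto)⟩

/-- If `p i` informs `x j` exactly for `i ≠ j`, where `i` and `j` range over `I`, then the graph of
the calls has cyclomatic number at least `#I - 2`. -/
theorem card_add_card_le_of_informs_iff_ne {ι : Type*} [DecidableEq ι] (L : List (V × V))
    (I : Finset ι) (p x : ι → V) (hself : ∀ i ∈ I, ¬ Informs L (p i) (x i))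
    (hne : ∀ i ∈ I, ∀ j ∈ I, i ≠ j → Informs L (p i) (x j)) :
    Fintype.card V + #I ≤ L.length + numComp L + 2 := by
  induction L using List.reverseRecOn generalizing I x with
  | nil =>
    by_contra! hlt
    have hc := card_le_length_add_numComp ([] : List (V × V))
    obtain ⟨i, j, k, hi, hj, hk, hij, hik, hjk⟩ := two_lt_card_iff.1 (show 2 < #I by omega)
    have h1 : p i = x j := hne i hi j hj hij
    have h2 : p i = x k := hne i hi k hk hik
    have h3 : p j = x k := hne j hj k hk hjk
    exact hself j hj (h3.trans (h2.symm.trans h1))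
  | append_singleton L c ih =>
    obtain ⟨a, b⟩ := c
    rw [List.length_append, List.length_singleton]
    by_contra! hlt
    have hc := card_le_length_add_numComp (L ++ [(a, b)])
    rw [List.length_append, List.length_singleton] at hc
    -- After their call a and b know the same, so at most one index has its receiver among them. If
    -- the call closes a cycle, that index is dropped.
    have hone : ∀ i ∈ I, ∀ j ∈ I, (x i = a ∨ x i = b) → (x j = a ∨ x j = b) → i = j := by
      intro i hi j hj hxi hxj
      by_contra hij
      have h1 := hne i hi j hj hij
      have h2 : ∀ z, (z = a ∨ z = b) → (Informs (L ++ [(a, b)]) (p i) z ↔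
          Informs L (p i) a ∨ Informs L (p i) b) := by
        rintro z (rfl | rfl)
        exacts [informs_concat_left, informs_concat_right]
      exact hself i hi ((h2 _ hxi).2 ((h2 _ hxj).1 h1))
    by_cases hab : label L a = label L b
    · rw [numComp_concat_of_eq hab] at hlt
      set J := I.filter fun i => ¬ (x i = a ∨ x i = b) with hJ
      have hJc : #I ≤ #J + 1 := by
        rw [← card_filter_add_card_filter_not (s := I) fun i => x i = a ∨ x i = b, add_comm]
        refine Nat.add_le_add_left (card_le_one.2 fun i hi j hj => ?_) _
        rw [mem_filter] at hi hj
        exact hone i hi.1 j hj.1 hi.2 hj.2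
      have hJx : ∀ j ∈ J, ∀ u, Informs (L ++ [(a, b)]) u (x j) ↔ Informs L u (x j) := by
        intro j hj u
        have := (mem_filter.1 hj).2
        exact informs_concat_of_ne (fun h => this (Or.inl h)) fun h => this (Or.inr h)
      have := ih J x
        (fun i hi h => hself i (mem_filter.1 hi).1 ((hJx i hi _).2 h))
        (fun i hi j hj hij => (hJx j hj _).1 (hne i (mem_filter.1 hi).1 j (mem_filter.1 hj).1 hij))
      omega
    · have hn := numComp_concat_of_ne hab
      have hI3 : 2 < #I := by omega
      set T := I.filter fun i => ¬ (x i = a ∨ x i = b) with hT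
      have hTx : ∀ j ∈ T, ∀ u, Informs (L ++ [(a, b)]) u (x j) ↔ Informs L u (x j) := by
        intro j hj u
        have := (mem_filter.1 hj).2
        exact informs_concat_of_ne (fun h => this (Or.inl h)) fun h => this (Or.inr h)
      have hTc : #I ≤ #T + 1 := by
        rw [← card_filter_add_card_filter_not (s := I) fun i => x i = a ∨ x i = b, add_comm]
        refine Nat.add_le_add_left (card_le_one.2 fun i hi j hj => ?_) _
        rw [mem_filter] at hi hj
        exact hone i hi.1 j hj.1 hi.2 hj.2
      have hlab : ∀ i ∈ I, ∀ j ∈ T, i ≠ j → label L (p i) = label L (x j) := fun i hi j hj hij =>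
        ((hTx j hj _).1 (hne i hi j (mem_filter.1 hj).1 hij)).label_eq
      obtain ⟨j, hj, k, hk, hjk⟩ := one_lt_card.1 (show 1 < #T by omega)
      have hjI := (mem_filter.1 hj).1
      have hkI := (mem_filter.1 hk).1
      obtain ⟨l, hl, hlj, hlk⟩ : ∃ l ∈ I, l ≠ j ∧ l ≠ k := by
        by_contra! h
        have : I ⊆ {j, k} := fun l hl => by
          rw [mem_insert, mem_singleton]
          exact or_iff_not_imp_left.2 (h l hl)
        have := (card_le_card this).trans card_le_two
        omega
      have hp : ∀ i ∈ I, label L (p i) = label L (x j) := by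
        intro i hi
        rcases eq_or_ne i j with rfl | hij
        · rw [hlab i hi k hk hjk, ← hlab l hl k hk hlk, hlab l hl i hj hlj]
        · exact hlab i hi j hj hij
      -- If the call joins two components, all `p i` lie in one of them. A receiver at the call is
      -- replaced by the end in that component, since the other end hears from no `p i` before the
      -- call; no index is lost.
      set y : ι → V := fun i => if x i = a ∨ x i = b then
        (if label L a = label L (x j) then a else b) else x i with hy
      have hyT : ∀ i ∈ T, y i = x i := fun i hi => if_neg (mem_filter.1 hi).2
      have hyN : ∀ i, (x i = a ∨ x i = b) → ∀ m ∈ I,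
          (Informs (L ++ [(a, b)]) (p m) (x i) ↔ Informs L (p m) (y i)) := by
        intro i hi m hm
        have h1 : Informs (L ++ [(a, b)]) (p m) (x i) ↔
            Informs L (p m) a ∨ Informs L (p m) b := by
          rcases hi with h | h <;> rw [h]
          exacts [informs_concat_left, informs_concat_right]
        rw [h1]
        simp only [hy, if_pos hi]
        split_ifs with ha
        · refine or_iff_left fun h => hab ?_
          rw [ha, ← hp m hm, h.label_eq]
        · refine or_iff_right fun h => ha ?_
          rw [← hp m hm, h.label_eq]
      have hiff : ∀ i ∈ I, ∀ m ∈ I,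
          (Informs (L ++ [(a, b)]) (p m) (x i) ↔ Informs L (p m) (y i)) := by
        intro i hi m hm
        by_cases h : x i = a ∨ x i = b
        · exact hyN i h m hm
        · have hiT : i ∈ T := mem_filter.2 ⟨hi, h⟩
          rw [hyT i hiT]
          exact hTx i hiT _
      have := ih I y (fun i hi h => hself i hi ((hiff i hi i hi).2 h))
        (fun i hi m hm him => (hiff m hm i hi).1 (hne i hi m hm him))
      omega

end Label

end Gossip

/-! ### Cross-intersecting families of pairs -/

namespace Gossip

open Finset

section CrossIntersecting

variable {α : Type*} [DecidableEq α]

/-- If X is a star at c covering C, a pair of P avoiding c would contain all of the at least three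
other elements of C. -/
theorem forall_mem_of_forall_mem_cross {P X : Set (Sym2 α)} {C : Finset α} (hC : 4 ≤ #C)
    (hX : ∀ c ∈ C, ∃ f ∈ X, c ∈ f) (hcross : ∀ e ∈ P, ∀ f ∈ X, ∃ c ∈ e, c ∈ f) {c : α}
    (hc : ∀ f ∈ X, c ∈ f) : ∀ e ∈ P, c ∈ e := by
  intro e he
  by_contra hce
  have hsub : C.erase c ⊆ e.toFinset := fun d hd => by
    rw [mem_erase] at hd
    obtain ⟨f, hf, hdf⟩ := hX d hd.2
    obtain ⟨x, hxe, hxf⟩ := hcross e he f hf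
    rw [(Sym2.mem_and_mem_iff hd.1.symm).1 ⟨hc f hf, hdf⟩, Sym2.mem_iff] at hxf
    rcases hxf with rfl | rfl
    · exact absurd hxe hce
    · exact Sym2.mem_toFinset.2 hxe
  have h1 := card_le_card hsub
  have h2 : #e.toFinset ≤ 2 := by
    rw [Sym2.card_toFinset]
    split_ifs <;> norm_num
  have h3 := pred_card_le_card_erase (a := c) (s := C)
  omega

/-- Two cross-intersecting families of pairs covering the same set of at least four elements:
either all pairs share an element, or there are exactly four elements, forming a square. -/
theorem exists_common_or_square {P X : Set (Sym2 α)} {C : Finset α} (hC : 4 ≤ #C)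
    (hP : ∀ c, c ∈ C ↔ ∃ e ∈ P, c ∈ e) (hX : ∀ c, c ∈ C ↔ ∃ f ∈ X, c ∈ f)
    (hcross : ∀ e ∈ P, ∀ f ∈ X, ∃ c ∈ e, c ∈ f) :
    (∃ c, (∀ e ∈ P, c ∈ e) ∧ ∀ f ∈ X, c ∈ f) ∨
    ∃ a b c d, a ≠ b ∧ a ≠ c ∧ a ≠ d ∧ b ≠ c ∧ b ≠ d ∧ c ≠ d ∧ C = {a, b, c, d} ∧
      s(a, b) ∈ P ∧ s(c, d) ∈ P ∧ s(a, c) ∈ X ∧ s(b, d) ∈ X := by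
  by_cases hs : ∃ c, ∀ f ∈ X, c ∈ f
  · obtain ⟨c, hc⟩ := hs
    exact Or.inl ⟨c, forall_mem_of_forall_mem_cross hC (fun c hc => (hX c).1 hc) hcross hc, hc⟩
  right
  push Not at hs
  obtain ⟨c₀, hc₀⟩ : C.Nonempty := card_pos.1 (by omega)
  obtain ⟨e, he, -⟩ := (hP c₀).1 hc₀
  induction e with
  | h a b =>
  have haC : a ∈ C := (hP a).2 ⟨_, he, Sym2.mem_mk_left _ _⟩
  have hbC : b ∈ C := (hP b).2 ⟨_, he, Sym2.mem_mk_right _ _⟩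
  have hXab : ∀ f ∈ X, a ∈ f ∨ b ∈ f := fun f hf => by
    obtain ⟨x, hx, hxf⟩ := hcross _ he f hf
    rcases Sym2.mem_iff.1 hx with rfl | rfl
    exacts [Or.inl hxf, Or.inr hxf]
  obtain ⟨f₁, hf1, hbf1⟩ := hs b
  obtain ⟨f₂, hf2, haf2⟩ := hs a
  have haf1 := (hXab f₁ hf1).resolve_right hbf1
  have hbf2 := (hXab f₂ hf2).resolve_left haf2
  obtain ⟨u, rfl⟩ := haf1
  obtain ⟨w, rfl⟩ := hbf2
  have hab : a ≠ b := by
    rintro rfl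
    exact hbf1 (Sym2.mem_mk_left _ _)
  have hub : u ≠ b := by
    rintro rfl
    exact hbf1 (Sym2.mem_mk_right _ _)
  have hwa : w ≠ a := by
    rintro rfl
    exact haf2 (Sym2.mem_mk_right _ _)
  have huC : u ∈ C := (hX u).2 ⟨_, hf1, Sym2.mem_mk_right _ _⟩
  have hwC : w ∈ C := (hX w).2 ⟨_, hf2, Sym2.mem_mk_right _ _⟩
  have hPt : ∀ x y, s(x, y) ∈ P → (x = a ∨ x = u ∨ y = a ∨ y = u) ∧
      (x = b ∨ x = w ∨ y = b ∨ y = w) := by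
    intro x y hxy
    obtain ⟨z, hz, hz1⟩ := hcross _ hxy _ hf1
    obtain ⟨z', hz', hz2⟩ := hcross _ hxy _ hf2
    rw [Sym2.mem_iff] at hz hz1 hz' hz2
    grind
  have hnew : ∀ x y z : α, ∃ d ∈ C, d ≠ x ∧ d ≠ y ∧ d ≠ z := by
    intro x y z
    obtain ⟨d, hd, hd'⟩ := exists_mem_notMem_of_card_lt_card
      ((card_le_three (a := x) (b := y) (c := z)).trans_lt (show 3 < #C by omega))
    simp only [mem_insert, mem_singleton, not_or] at hd'
    exact ⟨d, hd, hd'⟩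
  -- Members of P meet both {a, u} and {b, w}. If u = w, a fourth element d can only be covered by
  -- {d, u} in P, and by {d, a} or {d, b} in X. If u ≠ w, C is {a, b, u, w}, and P contains either
  -- {u, w} or both {w, a} and {u, b}.
  by_cases huw : u = w
  · subst huw
    obtain ⟨d, hd, hda, hdb, hdu⟩ := hnew a b u
    have hdP : ∀ d ∈ C, d ≠ a → d ≠ b → d ≠ u → s(d, u) ∈ P := by
      intro d hd hda hdb hdu
      obtain ⟨e', he', y, rfl⟩ := (hP d).1 hd
      have := hPt d y he'
      have : y = u := by grind
      exact this ▸ he'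
    obtain ⟨f, hf, y, rfl⟩ := (hX d).1 hd
    have hyab : y = a ∨ y = b := by
      have := hXab _ hf
      simp only [Sym2.mem_iff] at this
      grind
    have hCsub : C = {a, b, d, u} := by
      ext x
      simp only [mem_insert, mem_singleton]
      constructor
      · intro hx
        by_contra! h
        obtain ⟨z, hz, hz'⟩ := hcross _ (hdP x hx h.1 h.2.1 h.2.2.2) _ hf
        rw [Sym2.mem_iff] at hz hz'
        grind
      · rintro (rfl | rfl | rfl | rfl) <;> assumption
    rcases hyab with rfl | rfl
    · exact ⟨y, b, d, u, hab, hda.symm, hwa.symm, hdb.symm, hub.symm, hdu, hCsub, he,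
        hdP d hd hda hdb hdu, Sym2.eq_swap ▸ hf, hf2⟩
    · refine ⟨y, a, d, u, hab.symm, hdb.symm, hub.symm, hda.symm, hwa.symm, hdu, ?_,
        Sym2.eq_swap ▸ he, hdP d hd hda hdb hdu, Sym2.eq_swap ▸ hf, hf1⟩
      rw [hCsub, insert_comm]
  · have hCsub : ∀ x ∈ C, x = a ∨ x = b ∨ x = u ∨ x = w := by
      intro x hx
      by_contra! h
      obtain ⟨e', he', y, rfl⟩ := (hP x).1 hx
      have := hPt x y he'
      grind
    have hua : u ≠ a := by
      rintro rfl
      obtain ⟨d, hd, h1, h2, h3⟩ := hnew u b w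
      have := hCsub d hd
      grind
    have hwb : w ≠ b := by
      rintro rfl
      obtain ⟨d, hd, h1, h2, h3⟩ := hnew a w u
      have := hCsub d hd
      grind
    have hCeq : C = {a, b, u, w} := by
      ext x
      simp only [mem_insert, mem_singleton]
      refine ⟨hCsub x, ?_⟩
      rintro (rfl | rfl | rfl | rfl) <;> assumption
    by_cases h34 : s(u, w) ∈ P
    · exact ⟨a, b, u, w, hab, hua.symm, hwa.symm, hub.symm, hwb.symm, huw, hCeq, he, h34, hf1,
        hf2⟩
    · obtain ⟨e₁, he1, y, rfl⟩ := (hP w).1 hwC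
      obtain ⟨e₂, he2, z, rfl⟩ := (hP u).1 huC
      have hy : y = a := by
        have h1 := hPt w y he1
        have h2 : y ≠ u := by
          rintro rfl
          exact h34 (Sym2.eq_swap ▸ he1)
        grind
      have hz : z = b := by
        have h1 := hPt u z he2
        have h2 : z ≠ w := by
          rintro rfl
          exact h34 he2
        grind
      subst hy hz
      refine ⟨y, w, u, z, hwa.symm, hua.symm, hab, huw ∘ Eq.symm, hwb, hub, ?_,
        Sym2.eq_swap ▸ he1, he2, hf1, Sym2.eq_swap ▸ hf2⟩
      rw [hCeq]
      ext x
      simp only [mem_insert, mem_singleton]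
      tauto

end CrossIntersecting

end Gossip

/-! ### Irreducible schemes read on components -/

namespace Gossip

open Finset SimpleGraph

section Core

set_option linter.unusedSectionVars false

variable {V : Type*} [DecidableEq V] {G : SimpleGraph V} {L : List (V × V)}
  {P X : Finset (Sym2 V)}

/-- The set of all persons occurring in a family of pairs. -/
def support (P : Finset (Sym2 V)) : Finset V := P.biUnion Sym2.toFinset

theorem mem_support {v : V} : v ∈ support P ↔ ∃ e ∈ P, v ∈ e := by
  simp [support]

theorem card_support (hP : IsMatching P) (hd : ∀ e ∈ P, ¬ e.IsDiag) :
    #(support P) = 2 * #P := by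
  rw [support, card_biUnion, sum_congr rfl fun e he => Sym2.card_toFinset_of_not_isDiag e (hd e he),
    sum_const, smul_eq_mul, mul_comm]
  intro e he f hf hef
  rw [Function.onFun, Finset.disjoint_left]
  intro v hve hvf
  rw [Sym2.mem_toFinset] at hve hvf
  exact hef (hP e he f hf v hve hvf)

theorem Scheme.not_isDiag_of_not_expert (h : Scheme G L P X) (hE : ∀ v, ¬ Expert L P v) :
    ∀ f ∈ X, ¬ f.IsDiag := by
  intro f hf hd
  induction f with
  | h v w =>
  obtain rfl : v = w := hd
  refine hE v fun e he => ?_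
  obtain ⟨u, hu, z, hz, huz⟩ := h.informs e he _ hf
  have : z = v := by simpa using hz
  exact ⟨u, hu, this ▸ huz⟩

/-- In a pair of receivers neither of whom knows everything, each contributes something. -/
theorem Scheme.exists_informs_of_not_expert (h : Scheme G L P X) {v w : V}
    (hw : ¬ Expert L P w) (hf : s(v, w) ∈ X) :
    ∃ e ∈ P, (∀ u ∈ e, ¬ Informs L u w) ∧ ∃ u ∈ e, Informs L u v := by
  unfold Expert at hw
  push Not at hw
  obtain ⟨e, he, hew⟩ := hw
  obtain ⟨u, hu, z, hz, huz⟩ := h.informs e he _ hf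
  rcases Sym2.mem_iff.1 hz with rfl | rfl
  · exact ⟨e, he, hew, u, hu, huz⟩
  · exact absurd huz (hew u hu)

/-- The partner of a receiver lacks some sender, so the receiver itself hears from that sender,
inside its own component. -/
theorem Scheme.image_label_support_subset (h : Scheme G L P X) (hE : ∀ v, ¬ Expert L P v) :
    (support X).image (label L) ⊆ (support P).image (label L) := by
  intro c hc
  obtain ⟨v, hv, rfl⟩ := mem_image.1 hc
  obtain ⟨f, hf, w, rfl⟩ := mem_support.1 hv
  obtain ⟨e, he, -, u, hu, huv⟩ := h.exists_informs_of_not_expert (hE w) hf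
  exact mem_image.2 ⟨u, mem_support.2 ⟨e, he, hu⟩, huv.label_eq⟩

theorem Scheme.image_label_support (h : Scheme G L P X) (hE : ∀ v, ¬ Expert L P v)
    (hB : ∀ v, ¬ Expert L.reverse X v) :
    (support X).image (label L) = (support P).image (label L) := by
  refine (h.image_label_support_subset hE).antisymm ?_
  intro c hc
  obtain ⟨v, hv, rfl⟩ := mem_image.1 hc
  obtain ⟨f, hf, w, rfl⟩ := mem_support.1 hv
  obtain ⟨e, he, -, u, hu, huv⟩ := h.reverse.exists_informs_of_not_expert (hB w) hf
  exact mem_image.2 ⟨u, mem_support.2 ⟨e, he, hu⟩, (informs_reverse.1 huv).label_eq.symm⟩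

/-- All pairs meet a common component `c` of the graph of the calls: every other component forces
an independent cycle. -/
theorem Scheme.card_add_card_le_of_common [Fintype V] (h : Scheme G L P X)
    (hE : ∀ v, ¬ Expert L P v) {c : V} (hPc : ∀ e ∈ P, ∃ u ∈ e, label L u = c)
    (hXc : ∀ f ∈ X, ∃ v ∈ f, label L v = c) :
    Fintype.card V + #((support X).image (label L)) ≤ L.length + numComp L + 3 := by
  set C := (support X).image (label L) with hC
  -- For a component i ≠ c take a receiving pair between c and i. Its member x in c misses some
  -- sender pair, which must then reach i and so also joins c to i. Across different i and j,
  -- information can pass only inside c, so p of i informs x of j.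
  have hx : ∀ i ∈ C.erase c, ∃ p x x', label L p = c ∧ label L x = c ∧ label L x' = i ∧
      s(x, x') ∈ X ∧ ¬ Informs L p x ∧ ∃ u, s(p, u) ∈ P ∧ label L u = i := by
    intro i hi
    rw [mem_erase] at hi
    obtain ⟨v, hv, rfl⟩ := mem_image.1 hi.2
    obtain ⟨f, hf, hvf⟩ := mem_support.1 hv
    obtain ⟨x, hxf, hxc⟩ := hXc f hf
    have hne : x ≠ v := by
      rintro rfl
      exact hi.1 hxc
    obtain rfl := (Sym2.mem_and_mem_iff hne).1 ⟨hxf, hvf⟩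
    rw [Sym2.eq_swap] at hf
    obtain ⟨e, he, hex, u, hu, huv⟩ := h.exists_informs_of_not_expert (hE x) hf
    obtain ⟨p, hp, hpc⟩ := hPc e he
    have hpu : p ≠ u := by
      rintro rfl
      exact hi.1 (huv.label_eq.symm.trans hpc)
    obtain rfl := (Sym2.mem_and_mem_iff hpu).1 ⟨hp, hu⟩
    exact ⟨p, x, v, hpc, hxc, rfl, Sym2.eq_swap ▸ hf, hex p hp, u, he, huv.label_eq⟩
  choose! p x x' hp hx hx' hxX hpx u hpu hu using hx
  have key := card_add_card_le_of_informs_iff_ne L (C.erase c) p x hpx (by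
    intro i hi j hj hij
    obtain ⟨y, hy, z, hz, hyz⟩ := h.informs _ (hpu i hi) _ (hxX j hj)
    have hl := hyz.label_eq
    have hic := (mem_erase.1 hi).1
    have hjc := (mem_erase.1 hj).1
    rcases Sym2.mem_iff.1 hy with rfl | rfl <;> rcases Sym2.mem_iff.1 hz with rfl | rfl
    · exact hyz
    · rw [hp i hi, hx' j hj] at hl
      exact absurd hl.symm hjc
    · rw [hu i hi, hx j hj] at hl
      exact absurd hl hic
    · rw [hu i hi, hx' j hj] at hl
      exact absurd hl hij)
  have := pred_card_le_card_erase (a := c) (s := C)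
  omega

/-- A component `j` all of whose receivers are paired with receivers in the component `i`, while
no pair of senders lies within these two components, is a single vertex. -/
theorem eq_of_isolated (hG : G.GirthGeFive) {R : V → V → Prop} {φ : V → V}
    (hedge : ∀ f ∈ X, f ∈ G.edgeSet) (hX : IsMatching X)
    (hinf : ∀ e ∈ P, ∀ f ∈ X, ∃ u ∈ e, ∃ v ∈ f, R u v) (hφ : ∀ u v, R u v → φ u = φ v)
    (hadj : ∀ u v, R u v → R v u → u ≠ v → G.Adj u v) {i j : V} (hij : i ≠ j)
    (hP : ∀ v, (φ v = i ∨ φ v = j) → ∃ e ∈ P, v ∈ e) (hXj : ∀ v, φ v = j → ∃ f ∈ X, v ∈ f)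
    (hXij : ∀ v w, s(v, w) ∈ X → φ w = j → φ v = i)
    (hPij : ∀ v w, s(v, w) ∈ P → (φ v = i ∨ φ v = j) → ¬ (φ w = i ∨ φ w = j))
    {w w' : V} (hw : φ w = j) (hw' : φ w' = j) : w = w' := by
  by_contra hne
  obtain ⟨f, hf, x, rfl⟩ := hXj w hw
  obtain ⟨f', hf', x', rfl⟩ := hXj w' hw'
  rw [Sym2.eq_swap] at hf hf'
  have hx := hXij _ _ hf hw
  have hx' := hXij _ _ hf' hw'
  have hxw' : x ≠ w' := by
    rintro rfl
    exact hij (hx.symm.trans hw')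
  have hxx' : x ≠ x' := by
    rintro rfl
    have := hX _ hf _ hf' x (Sym2.mem_mk_left _ _) (Sym2.mem_mk_left _ _)
    rcases Sym2.mem_iff.1 (this ▸ Sym2.mem_mk_right x w : w ∈ s(x, w')) with h | h
    · exact hij (hx.symm.trans (h ▸ hw))
    · exact hne h
  -- The sending partner of y lies outside both components, so y has to do the informing itself.
  -- Hence w, w' inform each other, and so do their partners x, x'; by `hadj` these are edges, and
  -- they close a four-cycle with the two receiving pairs.
  have key : ∀ y, (φ y = i ∨ φ y = j) → ∀ a b, s(a, b) ∈ X → φ a = i → φ b = j →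
      ∃ v ∈ s(a, b), R y v := by
    intro y hy a b hab ha hb
    obtain ⟨e, he, t, rfl⟩ := hP y hy
    obtain ⟨u, hu, v, hv, huv⟩ := hinf _ he _ hab
    rcases Sym2.mem_iff.1 hu with rfl | rfl
    · exact ⟨v, hv, huv⟩
    · refine absurd ?_ (hPij y u he hy)
      have := hφ u v huv
      rcases Sym2.mem_iff.1 hv with rfl | rfl
      exacts [Or.inl (this.trans ha), Or.inr (this.trans hb)]
  have keyj : ∀ y, φ y = j → ∀ a b, s(a, b) ∈ X → φ a = i → φ b = j → R y b := by
    intro y hy a b hab ha hb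
    obtain ⟨v, hv, hyv⟩ := key y (Or.inr hy) a b hab ha hb
    rcases Sym2.mem_iff.1 hv with rfl | rfl
    · exact absurd (ha.symm.trans ((hφ _ _ hyv).symm.trans hy)) hij
    · exact hyv
  have keyi : ∀ y, φ y = i → ∀ a b, s(a, b) ∈ X → φ a = i → φ b = j → R y a := by
    intro y hy a b hab ha hb
    obtain ⟨v, hv, hyv⟩ := key y (Or.inl hy) a b hab ha hb
    rcases Sym2.mem_iff.1 hv with rfl | rfl
    · exact hyv
    · exact absurd (hy.symm.trans ((hφ _ _ hyv).trans hb)) hij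
  have h1 := hadj w w' (keyj w hw _ _ hf' hx' hw') (keyj w' hw' _ _ hf hx hw) hne
  have h2 := hadj x x' (keyi x hx _ _ hf' hx' hw') (keyi x' hx' _ _ hf hx hw) hxx'
  have h3 : G.Adj x w := hedge _ hf
  have h4 : G.Adj x' w' := hedge _ hf'
  have := hG.common_unique hxw' h3 h1 h2 h4
  exact hij (hx'.symm.trans (this ▸ hw))

/-- The degree sum of a vertex set containing all members of a set of edges. -/
theorem two_mul_card_le_degSum [DecidableRel G.Adj] {W : Finset V} {F : Finset (Sym2 V)}
    (hF : ∀ e ∈ F, e ∈ G.edgeSet) (hFW : ∀ e ∈ F, ∀ v ∈ e, v ∈ W) :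
    2 * #F ≤ G.degSum W := by
  have h1 : ∀ v ∈ W, #(F.filter fun e => v ∈ e) ≤ G.degIn W v := by
    intro v _
    refine (card_le_card fun e he => ?_).trans
      (card_image_le (s := W.filter (G.Adj v)) (f := fun u => s(v, u)))
    rw [mem_filter] at he
    obtain ⟨u, rfl⟩ := he.2
    exact mem_image.2 ⟨u, mem_filter.2 ⟨hFW _ he.1 u (Sym2.mem_mk_right _ _), hF _ he.1⟩, rfl⟩
  have h2 : ∑ v ∈ W, #(F.filter fun e => v ∈ e) = ∑ e ∈ F, #(W.filter fun v => v ∈ e) :=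
    sum_card_bipartiteAbove_eq_sum_card_bipartiteBelow _
  have h3 : ∀ e ∈ F, #(W.filter fun v => v ∈ e) = 2 := by
    intro e he
    rw [← Sym2.card_toFinset_of_not_isDiag e (G.not_isDiag_of_mem_edgeSet (hF e he))]
    congr 1
    ext v
    simp only [mem_filter, Sym2.mem_toFinset, and_iff_right_iff_imp]
    exact hFW e he v
  calc 2 * #F = ∑ e ∈ F, #(W.filter fun v => v ∈ e) := by
        rw [sum_congr rfl h3, sum_const, smul_eq_mul, mul_comm]
    _ ≤ G.degSum W := by
        rw [← h2]
        exact sum_le_sum h1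

end Core

end Gossip

/-! ### The square case and the lower bound on calls -/

namespace Gossip

open Finset SimpleGraph

section Irreducible

set_option linter.unusedSectionVars false

variable {V : Type*} [DecidableEq V] {G : SimpleGraph V} {L : List (V × V)}
  {P X : Finset (Sym2 V)}

theorem eq_or_eq_of_eq_right {α : Type*} {p q i j k : α} (h : p = i ∨ p = j ∨ q = i ∨ q = j)
    (hq : q = k) (hi : k ≠ i) (hj : k ≠ j) : p = i ∨ p = j := by
  subst hq
  tauto

theorem not_of_meets_compl {α : Type*} {p q i j k l : α} (h : p = k ∨ p = l ∨ q = k ∨ q = l)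
    (hik : i ≠ k) (hil : i ≠ l) (hjk : j ≠ k) (hjl : j ≠ l) (hp : p = i ∨ p = j) :
    ¬ (q = i ∨ q = j) := by
  rintro hq
  rcases h with rfl | rfl | rfl | rfl <;> rcases hp with hp | hp <;> rcases hq with hq | hq <;>
    simp_all

/-- In the square case two components are single vertices. -/
theorem Scheme.exists_isolated (h : Scheme G L P X) (hG : G.GirthGeFive)
    (hPd : ∀ e ∈ P, ¬ e.IsDiag) (hXd : ∀ f ∈ X, ¬ f.IsDiag)
    (hadj : ∀ u v, Informs L u v → Informs L v u → u ≠ v → G.Adj u v) {A : Finset V}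
    {a b c d : V} (hA : ∀ v, v ∈ A ↔ label L v = a ∨ label L v = b ∨ label L v = c ∨ label L v = d)
    (hab : a ≠ b) (hac : a ≠ c) (had : a ≠ d) (hbc : b ≠ c) (hbd : b ≠ d) (hcd : c ≠ d)
    (hAP : ∀ v ∈ A, ∃ e ∈ P, v ∈ e) (hAX : ∀ v ∈ A, ∃ f ∈ X, v ∈ f)
    (h1 : ∃ e ∈ P, e.map (label L) = s(a, b)) (h2 : ∃ e ∈ P, e.map (label L) = s(c, d))
    (h3 : ∃ f ∈ X, f.map (label L) = s(a, c)) (h4 : ∃ f ∈ X, f.map (label L) = s(b, d)) :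
    ∃ x ∈ A, ∃ y ∈ A, x ≠ y ∧ (∀ v, label L v = label L x → v = x) ∧
      ∀ v, label L v = label L y → v = y := by
  have hPe : ∀ e ∈ P, e ∈ G.edgeSet := fun e he => h.left_edge e he (hPd e he)
  have hXe : ∀ f ∈ X, f ∈ G.edgeSet := fun f hf => h.right_edge f hf (hXd f hf)
  have hcr : ∀ e ∈ P, ∀ f ∈ X, ∃ z, z ∈ e.map (label L) ∧ z ∈ f.map (label L) := by
    intro e he f hf
    obtain ⟨u, hu, v, hv, huv⟩ := h.informs e he f hf
    exact ⟨label L u, Sym2.mem_map.2 ⟨u, hu, rfl⟩, Sym2.mem_map.2 ⟨v, hv, huv.label_eq.symm⟩⟩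
  have hPX : ∀ v w v' w', s(v, w) ∈ P → s(v', w') ∈ X →
      label L v = label L v' ∨ label L v = label L w' ∨
      label L w = label L v' ∨ label L w = label L w' := by
    intro v w v' w' hv hv'
    obtain ⟨z, hz, hz'⟩ := hcr _ hv _ hv'
    rw [Sym2.map_mk, Sym2.mem_iff] at hz hz'
    grind
  have hPt : ∀ v w, s(v, w) ∈ P →
      (label L v = a ∨ label L v = c ∨ label L w = a ∨ label L w = c) ∧
      (label L v = b ∨ label L v = d ∨ label L w = b ∨ label L w = d) := by
    intro v w hv
    obtain ⟨f, hf, hf'⟩ := h3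
    obtain ⟨g, hg, hg'⟩ := h4
    obtain ⟨z, hz, hz'⟩ := hcr _ hv f hf
    obtain ⟨y, hy, hy'⟩ := hcr _ hv g hg
    rw [hf'] at hz'
    rw [hg'] at hy'
    rw [Sym2.map_mk, Sym2.mem_iff] at hz hy
    rw [Sym2.mem_iff] at hz' hy'
    grind
  have hXt : ∀ v w, s(v, w) ∈ X →
      (label L v = a ∨ label L v = b ∨ label L w = a ∨ label L w = b) ∧
      (label L v = c ∨ label L v = d ∨ label L w = c ∨ label L w = d) := by
    intro v w hv
    obtain ⟨f, hf, hf'⟩ := h1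
    obtain ⟨g, hg, hg'⟩ := h2
    obtain ⟨z, hz, hz'⟩ := hcr f hf _ hv
    obtain ⟨y, hy, hy'⟩ := hcr g hg _ hv
    rw [hf'] at hz
    rw [hg'] at hy
    rw [Sym2.map_mk, Sym2.mem_iff] at hz' hy'
    rw [Sym2.mem_iff] at hz hy
    grind
  have hex : ∀ {S : Finset (Sym2 V)} {i j : V}, (∃ e ∈ S, e.map (label L) = s(i, j)) →
      ∃ x y, label L x = i ∧ label L y = j := by
    rintro S i j ⟨e, he, hij⟩
    induction e with
    | h x y =>
    rw [Sym2.map_mk, Sym2.eq_iff] at hij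
    rcases hij with ⟨hx, hy⟩ | ⟨hx, hy⟩
    exacts [⟨x, y, hx, hy⟩, ⟨y, x, hy, hx⟩]
  obtain ⟨xa, xb, hxa, hxb⟩ := hex h1
  obtain ⟨xc, xd, hxc, hxd⟩ := hex h2
  have right := fun i j => eq_of_isolated (i := i) (j := j) hG hXe h.right_matching h.informs
    (fun _ _ => Informs.label_eq) hadj
  have left := fun i j => eq_of_isolated (i := i) (j := j) hG hPe h.left_matching
    (fun f hf e he => by
      obtain ⟨u, hu, v, hv, huv⟩ := h.informs e he f hf
      exact ⟨v, hv, u, hu, huv⟩)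
    (R := fun u v => Informs L v u) (φ := label L) (fun _ _ h => h.label_eq.symm)
    (fun u v h1 h2 => hadj u v h2 h1)
  have hAi : ∀ {i}, (i = a ∨ i = b ∨ i = c ∨ i = d) → ∀ v, label L v = i → v ∈ A := by
    rintro i hi v rfl
    exact (hA v).2 hi
  have finish : ∀ x y i j, label L x = i → label L y = j → i ≠ j →
      (i = a ∨ i = b ∨ i = c ∨ i = d) → (j = a ∨ j = b ∨ j = c ∨ j = d) →
      (∀ w w', label L w = i → label L w' = i → w = w') →
      (∀ w w', label L w = j → label L w' = j → w = w') →
      ∃ x ∈ A, ∃ y ∈ A, x ≠ y ∧ (∀ v, label L v = label L x → v = x) ∧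
        ∀ v, label L v = label L y → v = y := by
    intro x y i j hx hy hij hi hj hi' hj'
    refine ⟨x, hAi hi x hx, y, hAi hj y hy, ?_, fun v hv => hi' v x (hv.trans hx) hx,
      fun v hv => hj' v y (hv.trans hy) hy⟩
    rintro rfl
    exact hij (hx.symm.trans hy)
  have hPA := fun v hv => hAP v ((hA v).2 hv)
  have hXA := fun v hv => hAX v ((hA v).2 hv)
  -- Sender pairs join {a, c} to {b, d}, receiver pairs {a, b} to {c, d}. If receiver types ad and
  -- bc both occur, senders are only of types ab and cd, and a, b are singletons. Without type bc,
  -- receivers in b pair only with d and those in c only with a, so b, c are singletons; without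
  -- type ad, a and d are.
  by_cases hX14 : ∃ v w, s(v, w) ∈ X ∧ label L v = a ∧ label L w = d
  · by_cases hX23 : ∃ v w, s(v, w) ∈ X ∧ label L v = b ∧ label L w = c
    · obtain ⟨v₁, w₁, hvw1, rfl, rfl⟩ := hX14
      obtain ⟨v₂, w₂, hvw2, rfl, rfl⟩ := hX23
      refine finish xa xb _ _ hxa hxb hab (Or.inl rfl) (Or.inr (Or.inl rfl))
        (fun w w' => left _ _ hab.symm (fun v hv => hXA v (by tauto)) (fun v hv => hPA v (by tauto))
          ?_ fun v w hvw => not_of_meets_compl (hXt v w hvw).2 hbc hbd hac had)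
        (fun w w' => left _ _ hab (fun v hv => hXA v (by tauto)) (fun v hv => hPA v (by tauto))
          ?_ fun v w hvw => not_of_meets_compl (hXt v w hvw).2 hac had hbc hbd)
      · intro v w hvw hw
        rcases eq_or_eq_of_eq_right (hPt v w hvw).2 hw hab had with h5 | h5
        · exact h5
        · have := eq_or_eq_of_eq_right (hPX _ _ _ _ hvw hvw2) hw hab hac
          rw [h5] at this
          exact absurd this (not_or.2 ⟨hbd.symm, hcd.symm⟩)
      · intro v w hvw hw
        rcases eq_or_eq_of_eq_right (hPt v w hvw).1 hw hab.symm hbc with h5 | h5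
        · exact h5
        · have := eq_or_eq_of_eq_right (hPX _ _ _ _ hvw hvw1) hw hab.symm hbd
          rw [h5] at this
          exact absurd this (not_or.2 ⟨hac.symm, hcd⟩)
    · refine finish xb xc b c hxb hxc hbc (by tauto) (by tauto)
        (fun w w' => right d b hbd.symm (fun v hv => hPA v (by tauto))
          (fun v hv => hXA v (by tauto)) ?_
          fun v w hvw => not_of_meets_compl (hPt v w hvw).1 had.symm hcd.symm hab.symm hbc)
        (fun w w' => right a c hac (fun v hv => hPA v (by tauto)) (fun v hv => hXA v (by tauto)) ?_
          fun v w hvw => not_of_meets_compl (hPt v w hvw).2 hab had hbc.symm hcd)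
      · intro v w hvw hw
        exact (eq_or_eq_of_eq_right (hXt v w hvw).2 hw hbc hbd).resolve_left
          fun h5 => hX23 ⟨w, v, Sym2.eq_swap ▸ hvw, hw, h5⟩
      · intro v w hvw hw
        exact (eq_or_eq_of_eq_right (hXt v w hvw).1 hw hac.symm hbc.symm).resolve_right
          fun h5 => hX23 ⟨v, w, hvw, h5, hw⟩
  · refine finish xa xd a d hxa hxd had (by tauto) (by tauto)
      (fun w w' => right c a hac.symm (fun v hv => hPA v (by tauto)) (fun v hv => hXA v (by tauto))
        ?_ fun v w hvw => not_of_meets_compl (hPt v w hvw).2 hbc.symm hcd hab had)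
      (fun w w' => right b d hbd (fun v hv => hPA v (by tauto)) (fun v hv => hXA v (by tauto))
        ?_ fun v w hvw => not_of_meets_compl (hPt v w hvw).1 hab.symm hbc had.symm hcd.symm)
    · intro v w hvw hw
      exact (eq_or_eq_of_eq_right (hXt v w hvw).2 hw hac had).resolve_right
        fun h5 => hX14 ⟨w, v, Sym2.eq_swap ▸ hvw, hw, h5⟩
    · intro v w hvw hw
      exact (eq_or_eq_of_eq_right (hXt v w hvw).1 hw had.symm hbd.symm).resolve_left
        fun h5 => hX14 ⟨v, w, hvw, h5, hw⟩

variable [Fintype V]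

theorem Scheme.card_add_card_le_of_not_expert (hG : G.GirthGeFive) (hV : Fintype.card V ≤ 16)
    (h : Scheme G L P X) (hE : ∀ v, ¬ Expert L P v)
    (hB : ∀ v, ¬ Expert L.reverse X v) : #P + #X ≤ L.length + 3 := by
  classical
  by_contra! hlt
  have hXd := h.not_isDiag_of_not_expert hE
  have hPd := h.reverse.not_isDiag_of_not_expert hB
  have hPc := card_support h.left_matching hPd
  have hXc := card_support h.right_matching hXd
  have hC := h.image_label_support hE hB
  set C := (support P).image (label L) with hCdef
  set A := univ.filter fun v => label L v ∈ C with hA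
  have hPA : support P ⊆ A := fun v hv => mem_filter.2 ⟨mem_univ v, mem_image_of_mem _ hv⟩
  have hXA : support X ⊆ A := fun v hv =>
    mem_filter.2 ⟨mem_univ v, hC ▸ mem_image_of_mem (label L) hv⟩
  have hPA' := card_le_card hPA
  have hXA' := card_le_card hXA
  have hAc : #A + #Aᶜ = Fintype.card V := card_add_card_compl A
  have hnum : numComp L ≤ #C + #(Aᶜ.image (label L)) := by
    refine (card_le_card ?_).trans (card_union_le _ _)
    intro y hy
    obtain ⟨v, -, rfl⟩ := mem_image.1 hy
    rw [mem_union]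
    by_cases hv : label L v ∈ C
    · exact Or.inl hv
    · refine Or.inr (mem_image_of_mem _ (mem_compl.2 fun hvA => hv (mem_filter.1 hvA).2))
  have himg : #(Aᶜ.image (label L)) ≤ #Aᶜ := card_image_le
  have hgen := card_le_length_add_numComp L
  -- Disjointness of pairs gives |L| + 4 ≤ #P + #X ≤ #A, so n ≤ |L| + `numComp L` ≤ (#A - 4) + #C +
  -- #Aᶜ = n - 4 + #C.
  have hC4 : 4 ≤ #C := by omega
  have hmemP : ∀ c, c ∈ C ↔ ∃ e ∈ (Sym2.map (label L)) '' (P : Set (Sym2 V)), c ∈ e := by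
    intro c
    simp only [hCdef, mem_image, mem_support, Set.mem_image, mem_coe, exists_exists_and_eq_and,
      Sym2.mem_map]
    grind
  have hmemX : ∀ c, c ∈ C ↔ ∃ e ∈ (Sym2.map (label L)) '' (X : Set (Sym2 V)), c ∈ e := by
    intro c
    rw [← hC]
    simp only [mem_image, mem_support, Set.mem_image, mem_coe, exists_exists_and_eq_and,
      Sym2.mem_map]
    grind
  have hcross : ∀ e ∈ (Sym2.map (label L)) '' (P : Set (Sym2 V)),
      ∀ f ∈ (Sym2.map (label L)) '' (X : Set (Sym2 V)), ∃ c ∈ e, c ∈ f := by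
    rintro _ ⟨e, he, rfl⟩ _ ⟨f, hf, rfl⟩
    obtain ⟨u, hu, v, hv, huv⟩ := h.informs e he f hf
    exact ⟨label L u, Sym2.mem_map.2 ⟨u, hu, rfl⟩, Sym2.mem_map.2 ⟨v, hv, huv.label_eq.symm⟩⟩
  rcases exists_common_or_square hC4 hmemP hmemX hcross with ⟨c, hcP, hcX⟩ |
    ⟨a, b, c, d, hab, hac, had, hbc, hbd, hcd, hCeq, h1, h2, h3, h4⟩
  · have := h.card_add_card_le_of_common hE (c := c)
      (fun e he => Sym2.mem_map.1 (hcP _ ⟨e, he, rfl⟩))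
      (fun f hf => Sym2.mem_map.1 (hcX _ ⟨f, hf, rfl⟩))
    rw [hC] at this
    omega
  have hC4' : #C ≤ 4 := by
    rw [hCeq]
    exact card_le_four
  -- With #C = 4 that count is tight throughout: P and X both cover A, the calls form a forest, and
  -- persons outside A make no calls.
  have hPeq : support P = A := eq_of_subset_of_card_le hPA (by omega)
  have hXeq : support X = A := eq_of_subset_of_card_le hXA (by omega)
  have hforest : L.length + numComp L ≤ Fintype.card V := by omega
  have hinj : Set.InjOn (label L) (Aᶜ : Finset V) := card_image_iff.1 (by omega)
  have hadj : ∀ u v, Informs L u v → Informs L v u → u ≠ v → G.Adj u v := by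
    intro u v huv hvu hne
    rcases exists_mem_of_informs_of_informs hforest hne huv hvu with h' | h'
    exacts [h.adj _ h', (h.adj _ h').symm]
  have hLA : ∀ x ∈ L, x.1 ∈ A := by
    intro x hx
    by_contra h1
    have hl := label_eq_of_mem hx
    have h2 : x.2 ∉ A := fun h2 => h1 (mem_filter.2 ⟨mem_univ _, hl ▸ (mem_filter.1 h2).2⟩)
    exact (h.adj x hx).ne (hinj (by simpa using h1) (by simpa using h2) hl)
  have hLA2 : ∀ x ∈ L, x.2 ∈ A := fun x hx => mem_filter.2 ⟨mem_univ _,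
    label_eq_of_mem hx ▸ (mem_filter.1 (hLA x hx)).2⟩
  set F := (edges L).toFinset ∪ P ∪ X with hF
  have hFc : #F = L.length + #P + #X := by
    rw [hF, card_union_of_disjoint, card_union_of_disjoint, List.toFinset_card_of_nodup h.nodup,
      edges, List.length_map]
    · rw [Finset.disjoint_left]
      intro e he heP
      exact h.left_notMem e heP (List.mem_toFinset.1 he)
    · rw [Finset.disjoint_left]
      intro e he heX
      rcases mem_union.1 he with he | he
      · exact h.right_notMem e heX (List.mem_toFinset.1 he)
      · exact hPd e he (h.isDiag e he heX)
  have hFG : ∀ e ∈ F, e ∈ G.edgeSet := by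
    intro e he
    simp only [hF, mem_union, List.mem_toFinset, edges, List.mem_map] at he
    rcases he with (⟨x, hx, rfl⟩ | he) | he
    · exact h.adj x hx
    · exact h.left_edge e he (hPd e he)
    · exact h.right_edge e he (hXd e he)
  have hFA : ∀ e ∈ F, ∀ v ∈ e, v ∈ A := by
    intro e he v hv
    simp only [hF, mem_union, List.mem_toFinset, edges, List.mem_map] at he
    rcases he with (⟨x, hx, rfl⟩ | he) | he
    · rcases Sym2.mem_iff.1 hv with rfl | rfl
      exacts [hLA x hx, hLA2 x hx]
    · exact hPA (mem_support.2 ⟨e, he, hv⟩)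
    · exact hXA (mem_support.2 ⟨e, he, hv⟩)
  have hAcard : #A = 2 * #P := by rw [← hPeq, hPc]
  -- The calls and pairs are 2#A - 4 distinct edges inside A, and #A is even.
  rcases le_or_gt #A 14 with h14 | h14
  · have h5 := two_mul_card_le_degSum hFG hFA
    have h6 := degSum_add_eight_lt hG (W := A) (by omega) h14 ⟨#P, by omega⟩
    omega
  · have hmemA : ∀ v, v ∈ A ↔
        label L v = a ∨ label L v = b ∨ label L v = c ∨ label L v = d := fun v => by
      simp only [hA, mem_filter, mem_univ, true_and, hCeq, mem_insert, mem_singleton]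
    obtain ⟨x, hxA, y, hyA, hxy, hx, hy⟩ := h.exists_isolated hG hPd hXd hadj hmemA hab hac had hbc
      hbd hcd (fun v hv => mem_support.1 (hPeq ▸ hv)) (fun v hv => mem_support.1 (hXeq ▸ hv))
      h1 h2 h3 h4
    -- A person alone in its component makes no call and lies in at most one pair of each family.
    have hdeg : ∀ z, (∀ v, label L v = label L z → v = z) → #(F.filter fun e => z ∈ e) ≤ 2 := by
      intro z hz
      have hsub : (F.filter fun e => z ∈ e) ⊆
          (P.filter fun e => z ∈ e) ∪ X.filter fun e => z ∈ e := by
        intro e he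
        rw [mem_filter, hF, mem_union, mem_union] at he
        rw [mem_union, mem_filter, mem_filter]
        obtain ⟨(he | he) | he, hze⟩ := he
        · simp only [List.mem_toFinset, edges, List.mem_map] at he
          obtain ⟨x, hx, rfl⟩ := he
          have hl := label_eq_of_mem hx
          exfalso
          rcases Sym2.mem_iff.1 hze with rfl | rfl
          · exact (h.adj x hx).ne (hz _ hl.symm).symm
          · exact (h.adj x hx).ne (hz _ hl)
        · exact Or.inl ⟨he, hze⟩
        · exact Or.inr ⟨he, hze⟩
      have hle : ∀ {S : Finset (Sym2 V)}, IsMatching S → #(S.filter fun e => z ∈ e) ≤ 1 := by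
        intro S hS
        refine card_le_one.2 fun e he f hf => ?_
        rw [mem_filter] at he hf
        exact hS e he.1 f hf.1 z he.2 hf.2
      have h5 := (card_le_card hsub).trans (card_union_le _ _)
      have := hle h.left_matching
      have := hle h.right_matching
      omega
    set W := (A.erase x).erase y with hW
    have hWc : #W = 14 := by
      rw [hW, card_erase_of_mem (mem_erase.2 ⟨hxy.symm, hyA⟩), card_erase_of_mem hxA]
      have := card_le_univ A
      omega
    set F' := F.filter fun e => x ∉ e ∧ y ∉ e with hF'
    have hF'c : #F ≤ #F' + 4 := by
      have hsub : F ⊆ F' ∪ ((F.filter fun e => x ∈ e) ∪ F.filter fun e => y ∈ e) := by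
        intro e he
        simp only [hF', mem_union, mem_filter, he, true_and]
        tauto
      have h5 := (card_le_card hsub).trans (card_union_le _ _)
      have h6 := card_union_le (F.filter fun e => x ∈ e) (F.filter fun e => y ∈ e)
      have := hdeg x hx
      have := hdeg y hy
      omega
    have h5 := two_mul_card_le_degSum (W := W) (F := F')
      (fun e he => hFG e (mem_filter.1 he).1) (fun e he v hv => by
        obtain ⟨heF, hxe, hye⟩ := mem_filter.1 he
        refine mem_erase.2 ⟨?_, mem_erase.2 ⟨?_, hFA e heF v hv⟩⟩
        · rintro rfl
          exact hye hv
        · rintro rfl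
          exact hxe hv)
    -- At least 28 - 4 = 24 edges remain on fourteen vertices, of degree sum 48 > 47.
    have h6 := degSum_le_of_card_eq_fourteen hG hWc
    omega

/-- Gossiping without four-cycles and triangles among at most sixteen persons. -/
theorem Scheme.card_add_card_le (hG : G.GirthGeFive) (hV : Fintype.card V ≤ 16)
    (h : Scheme G L P X) (hP : P.Nonempty) (hX : X.Nonempty) : #P + #X ≤ L.length + 3 :=
  h.card_add_card_le_of_irreducible
    (fun _ _ _ h' _ _ hE hB => h'.card_add_card_le_of_not_expert hG hV hE hB) hP hX

end Irreducible

end Gossip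

/-! ### From temporal graphs to gossip schemes -/

theorem SimpleGraph.girthGeFive_of_five_le_egirth {V : Type*} {G : SimpleGraph V}
    (h : 5 ≤ G.egirth) : G.GirthGeFive where
  triangle_free a b c hab hbc hac := by
    have hc : (Walk.cons hab (.cons hbc (.cons hac.symm .nil))).IsCycle := by
      rw [Walk.cons_isCycle_iff]
      simp [hab.ne, hbc.ne, hac.ne, hab.ne.symm, hac.ne.symm]
    have := le_egirth.1 h _ _ hc
    simp only [Walk.length_cons, Walk.length_nil] at this
    norm_num at this
  common_unique a c b d hac hab hbc had hdc := by
    by_contra hbd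
    have hcyc : (Walk.cons hab (.cons hbc (.cons hdc.symm (.cons had.symm .nil)))).IsCycle := by
      rw [Walk.cons_isCycle_iff]
      simp [hab.ne, hbc.ne, hac, hbd, hab.ne.symm, hac.symm, had.ne.symm, hdc.ne.symm]
    have := le_egirth.1 h _ _ hcyc
    simp only [Walk.length_cons, Walk.length_nil] at this
    norm_num at this

theorem SimpleGraph.GirthGeFive.induce {V : Type*} {G : SimpleGraph V} (h : G.GirthGeFive)
    (S : Set V) : (G.induce S).GirthGeFive where
  triangle_free _ _ _ hab hbc hac := h.triangle_free hab hbc hac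
  common_unique _ _ _ _ hac hab hbc had hdc :=
    Subtype.ext (h.common_unique (Subtype.coe_ne_coe.2 hac) hab hbc had hdc)

/-- The first call has minimal time, so on a strictly increasing walk it can only be the first edge.
Ties between calls are harmless. -/
theorem Gossip.informs_of_walk {V : Type*} {G : SimpleGraph V} {τ : Sym2 V → ℕ}
    {L : List (V × V)} (hL : (edges L).Pairwise fun e f => τ e ≤ τ f) {u v : V} (p : G.Walk u v)
    (hp : ∀ e ∈ p.edges, e ∈ edges L) (hτ : p.edges.Pairwise fun e f => τ e < τ f) :
    Informs L u v := by
  induction L generalizing u with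
  | nil =>
    cases p with
    | nil => rfl
    | cons h q => simpa [edges] using hp _ List.mem_cons_self
  | cons c L ih =>
    rw [edges, List.map_cons, List.pairwise_cons] at hL
    replace hp : ∀ e ∈ p.edges, e = s(c.1, c.2) ∨ e ∈ edges L := fun e he =>
      List.mem_cons.1 (hp e he)
    by_cases hc : s(c.1, c.2) ∈ p.edges
    · cases p with
      | nil => simp at hc
      | @cons _ w _ h q =>
        rw [SimpleGraph.Walk.edges_cons, List.pairwise_cons] at hτ
        rw [SimpleGraph.Walk.edges_cons] at hp hc
        have hcu : s(c.1, c.2) = s(u, w) := by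
          refine (List.mem_cons.1 hc).resolve_right fun hcq => ?_
          have hlt := hτ.1 _ hcq
          rcases hp _ List.mem_cons_self with h1 | h1
          · rw [h1] at hlt
            exact hlt.false
          · exact (hL.1 _ h1).not_gt hlt
        have hq : Informs L w v := by
          refine ih hL.2 q (fun e he => ?_) hτ.2
          refine (hp e (List.mem_cons_of_mem _ he)).resolve_left fun h1 => ?_
          have := hτ.1 e he
          rw [h1, hcu] at this
          exact this.false
        rcases Sym2.eq_iff.1 hcu with ⟨h1, h2⟩ | ⟨h1, h2⟩
        · exact Or.inr (Or.inl ⟨h1.symm, h2 ▸ hq⟩)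
        · exact Or.inr (Or.inr ⟨h2.symm, h1 ▸ hq⟩)
    · refine Or.inl (ih hL.2 p (fun e he => ?_) hτ)
      refine (hp e he).resolve_left fun h1 => hc ?_
      rwa [h1] at he

namespace TemporalGraph

open Finset SimpleGraph Gossip

variable {V : Type*} {T : TemporalGraph V}

/-- The label of an edge with exactly one label. -/
def time (T : TemporalGraph V) (e : Sym2 V) : ℕ := (T.labels e).sup id

theorem IsSimple.labels_eq (hT : T.IsSimple) {e : Sym2 V} (he : e ∈ T.graph.edgeSet) :
    T.labels e = {T.time e} := by
  obtain ⟨t, ht⟩ := card_eq_one.1 (hT e he)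
  rw [time, ht, sup_singleton, id]

theorem IsHappy.time_ne (hT : T.IsHappy) {e f : Sym2 V} (he : e ∈ T.graph.edgeSet)
    (hf : f ∈ T.graph.edgeSet) (hef : e ≠ f) {v : V} (hve : v ∈ e) (hvf : v ∈ f) :
    T.time e ≠ T.time f := by
  have := hT.2 e he f hf hef ⟨v, hve, hvf⟩
  rwa [hT.1.labels_eq he, hT.1.labels_eq hf, disjoint_singleton] at this

/-- Consecutive edges are distinct and share a vertex, so properness makes each step strict. -/
theorem IsHappy.pairwise_time_lt (hT : T.IsHappy) {u v : V} {p : T.graph.Walk u v}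
    (hp : p.edges.Nodup) (h : p.edges.Pairwise fun e f => T.time e ≤ T.time f) :
    p.edges.Pairwise fun e f => T.time e < T.time f := by
  induction p with
  | nil => exact List.Pairwise.nil
  | @cons a b c hab q ih =>
    rw [Walk.edges_cons, List.pairwise_cons] at h ⊢
    rw [Walk.edges_cons, List.nodup_cons] at hp
    refine ⟨fun f hf => ?_, ih hp.2 h.2⟩
    cases q with
    | nil => simp at hf
    | @cons _ d _ hbd q =>
      rw [Walk.edges_cons] at h hp hf
      have hlt : T.time s(a, b) < T.time s(b, d) :=
        (h.1 _ List.mem_cons_self).lt_of_ne (hT.time_ne hab hbd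
          (fun he => hp.1 (he ▸ List.mem_cons_self)) (Sym2.mem_mk_right a b) (Sym2.mem_mk_left b d))
      rcases List.mem_cons.1 hf with rfl | hf
      exacts [hlt, hlt.trans_le ((List.pairwise_cons.1 h.2).1 f hf)]

theorem IsHappy.exists_walk (hT : T.IsHappy) {u v : V} (h : T.HasTemporalPath u v) :
    ∃ p : T.graph.Walk u v, p.edges.Pairwise fun e f => T.time e < T.time f := by
  obtain ⟨p, times, hp, hle, ht⟩ := h
  refine ⟨p, hT.pairwise_time_lt hp.isTrail.edges_nodup ?_⟩
  have key : ∀ (l : List (Sym2 V)) (ts : List ℕ), (∀ e ∈ l, e ∈ T.graph.edgeSet) →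
      List.Forall₂ (fun e t => t ∈ T.labels e) l ts → l.map T.time = ts := by
    intro l ts hl hts
    induction hts with
    | nil => rfl
    | cons h _ ih =>
      rw [hT.1.labels_eq (hl _ List.mem_cons_self), mem_singleton] at h
      rw [List.map_cons, ih fun e he => hl e (List.mem_cons_of_mem _ he), h]
  rw [← key _ _ (fun _ he => p.edges_subset_edgeSet he) ht] at hle
  exact List.pairwise_map.1 hle

theorem IsHappy.induce (hT : T.IsHappy) (S : Set V) : (T.induce S).IsHappy := by
  have hmem : ∀ e ∈ (T.induce S).graph.edgeSet, e.map Subtype.val ∈ T.graph.edgeSet := by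
    intro e he
    rw [← T.labels_nonempty_iff]
    exact ((T.induce S).labels_nonempty_iff e).2 he
  refine ⟨fun e he => hT.1 _ (hmem e he), fun e he f hf hef ⟨v, hve, hvf⟩ => ?_⟩
  exact hT.2 _ (hmem e he) _ (hmem f hf)
    (fun h => hef (Sym2.map.injective Subtype.val_injective h))
    ⟨v, Sym2.mem_map.2 ⟨v, hve, rfl⟩, Sym2.mem_map.2 ⟨v, hvf, rfl⟩⟩

/-- The edges of a happy temporally connected graph, in the order of their labels, form a gossip
scheme. -/
theorem IsHappy.exists_scheme [Fintype V] [DecidableEq V] (hT : T.IsHappy)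
    (hc : T.IsTemporallyConnected) {F : Finset (Sym2 V)} (hF : ∀ e, e ∈ F ↔ e ∈ T.graph.edgeSet) :
    ∃ L, L.length = #F ∧
      Scheme T.graph L (univ.image Sym2.diag) (univ.image Sym2.diag) := by
  classical
  let r : Sym2 V → Sym2 V → Prop := fun e f => T.time e ≤ T.time f
  have : Std.Total r := ⟨fun e f => le_total (T.time e) (T.time f)⟩
  have : IsTrans (Sym2 V) r := ⟨fun _ _ _ h1 h2 => le_trans h1 h2⟩
  set K := F.toList.insertionSort r with hK
  have hperm : K.Perm F.toList := List.perm_insertionSort r _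
  set L := K.map Quot.out with hL
  have hLK : edges L = K := by
    rw [edges, hL, List.map_map]
    conv_rhs => rw [← List.map_id K]
    refine List.map_congr_left fun e _ => ?_
    exact Quot.out_eq e
  have hmem : ∀ e, e ∈ edges L ↔ e ∈ T.graph.edgeSet := fun e => by
    rw [hLK, hperm.mem_iff, mem_toList, hF]
  have hd : ∀ e ∈ univ.image (Sym2.diag (α := V)), e.IsDiag := by
    intro e he
    obtain ⟨v, -, rfl⟩ := mem_image.1 he
    exact Sym2.diag_isDiag v
  have hnot : ∀ e ∈ univ.image (Sym2.diag (α := V)), e ∉ edges L := fun e he heL =>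
    T.graph.not_isDiag_of_mem_edgeSet ((hmem e).1 heL) (hd e he)
  have hmatch : IsMatching (univ.image (Sym2.diag (α := V))) := by
    intro e he f hf v hve hvf
    obtain ⟨x, -, rfl⟩ := mem_image.1 he
    obtain ⟨y, -, rfl⟩ := mem_image.1 hf
    have h1 : v = x := by simpa [Sym2.diag] using hve
    have h2 : v = y := by simpa [Sym2.diag] using hvf
    rw [← h1, ← h2]
  refine ⟨L, by rw [hL, List.length_map, hperm.length_eq, length_toList], ?_⟩
  exact {
    nodup := by
      rw [hLK]
      exact hperm.nodup_iff.2 (nodup_toList F)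
    adj := fun c hc => (hmem s(c.1, c.2)).1 (List.mem_map.2 ⟨c, hc, rfl⟩)
    left_edge := fun e he h => absurd (hd e he) h
    right_edge := fun e he h => absurd (hd e he) h
    left_notMem := hnot
    right_notMem := hnot
    isDiag := fun e he _ => hd e he
    left_matching := hmatch
    right_matching := hmatch
    informs := by
      intro e he f hf
      obtain ⟨u, -, rfl⟩ := mem_image.1 he
      obtain ⟨v, -, rfl⟩ := mem_image.1 hf
      obtain ⟨p, hp⟩ := hT.exists_walk (hc u v)
      refine ⟨u, Sym2.mem_mk_left u u, v, Sym2.mem_mk_left v v, ?_⟩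
      refine informs_of_walk ?_ p (fun e he => (hmem e).2 (p.edges_subset_edgeSet he)) hp
      rw [hLK]
      exact List.pairwise_insertionSort r _ }

/-- With at most sixteen vertices, gossiping gives 2n ≤ m + 3 and the extremal bound gives 2m + 6 <
4n, a contradiction. -/
theorem IsHappy.seventeen_le_card [Fintype V] (hT : T.IsHappy) (hG : T.graph.GirthGeFive)
    (hc : T.IsTemporallyConnected) (hV : 3 ≤ Fintype.card V) : 17 ≤ Fintype.card V := by
  classical
  by_contra! hlt
  set F := univ.filter fun e => e ∈ T.graph.edgeSet with hF
  obtain ⟨L, hL, h⟩ := hT.exists_scheme hc (F := F) (by simp [hF])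
  have hcard : #(univ.image (Sym2.diag (α := V))) = Fintype.card V := by
    rw [card_image_of_injective _ Sym2.diag_injective, card_univ]
  have hne : (univ.image (Sym2.diag (α := V))).Nonempty := card_pos.1 (by omega)
  have h1 := h.card_add_card_le hG (by omega) hne hne
  have h2 := two_mul_card_le_degSum (G := T.graph) (W := univ) (F := F)
    (fun e he => (mem_filter.1 he).2) fun _ _ _ _ => mem_univ _
  have h3 := degSum_add_six_lt hG (W := univ) (by rwa [card_univ]) (by rw [card_univ]; omega)
  rw [card_univ] at h3
  omega

end TemporalGraph

theorem mainTheorem9 {V : Type*} [Finite V] (T : TemporalGraph V) (hT : T.IsHappy)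
    (hgirth : 5 ≤ T.graph.egirth) (S : Finset V) (hS : T.IsNontrivialClosedTCC S) :
    17 ≤ S.card := by
  have hcard : Fintype.card (S : Set V) = S.card := Fintype.card_coe S
  rw [← hcard]
  refine (hT.induce S).seventeen_le_card ?_ hS.1 (hcard.symm ▸ hS.2)
  exact (SimpleGraph.girthGeFive_of_five_le_egirth hgirth).induce S
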